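/- Let $m\ge 0$ and $k\ge 1$ be integers and let $\alpha>0$ be real. For $z\in\mathbb R^m$, $\sigma\in\mathbb R^k$, $t>0$ and $\beta>\alpha$ consider the generalized Mehler kernel $$G_{\alpha,\beta}((z,\sigma),t)=\frac{2^k}{(4\pi t)^{\beta}}\int_{\mathbb R^k}e^{-\frac{i}{t}\langle\sigma,\lambda\rangle}\left(\frac{|\lambda|}{\sinh|\lambda|}\right)^{\alpha}e^{-\frac{|z|^2}{4t}\frac{|\lambda|}{\tanh|\lambda|}}\,d\lambda ,$$ and let $N(z,\sigma)=(|z|^4+16|\sigma|^2)^{1/4}$ be the Korányi gauge. Then for every $(z,\sigma)\in\mathbb R^m\times\mathbb R^k$ with $(z,\sigma)\neq(0,0)$ the integral over $\lambda$ converges absolutely for every $t>0$, the function $t\mapsto G_{\alpha,\alpha+k}((z,\sigma),t)$ is integrable on $(0,\infty)$, and $$\int_0^\infty G_{\alpha,\alpha+k}((z,\sigma),t)\,dt=\frac{2^{\alpha+2k-4}\,\Gamma\left(\frac{\alpha}{2}\right)\Gamma\left(\frac{\alpha+k-1}{2}\right)}{\pi^{\frac{2\alpha+k+1}{2}}}\;N(z,\sigma)^{-(2\alpha+2k-2)}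 .$$ -/

import Mathlib

open MeasureTheory

noncomputable section

/-- The Korányi-Folland gauge `N(z,σ) = (|z|⁴ + 16|σ|²)^{1/4}` on `ℝ^m × ℝ^k`. -/
def koranyiGauge {m k : ℕ} (z : EuclideanSpace ℝ (Fin m)) (σ : EuclideanSpace ℝ (Fin k)) : ℝ :=
  (‖z‖ ^ 4 + 16 * ‖σ‖ ^ 2) ^ (1 / 4 : ℝ)

/-- The integrand
`exp(-(i/t)⟨σ,λ⟩) (|λ|/sinh|λ|)^α exp(-(|z|²/(4t)) |λ|/tanh|λ|)` of the Fourier integral that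
defines the generalized Mehler kernel.  (The two quotients have limit `1` as `λ → 0`; the value of
the integrand at the single point `λ = 0`, a null set when `k ≥ 1`, plays no role.) -/
def mehlerIntegrand {m k : ℕ} (α : ℝ) (z : EuclideanSpace ℝ (Fin m))
    (σ : EuclideanSpace ℝ (Fin k)) (t : ℝ) (l : EuclideanSpace ℝ (Fin k)) : ℂ :=
  Complex.exp (-(Complex.I / (t : ℂ)) * ((inner ℝ σ l : ℝ) : ℂ)) *
    (((‖l‖ / Real.sinh ‖l‖) ^ α *
      Real.exp (-(‖z‖ ^ 2 / (4 * t)) * (‖l‖ / Real.tanh ‖l‖)) : ℝ) : ℂ)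

/-- The generalized Mehler kernel
`G_{α,β}((z,σ),t) = 2^k (4πt)^{-β} ∫_{ℝ^k} exp(-(i/t)⟨σ,λ⟩) (|λ|/sinh|λ|)^α
exp(-(|z|²/(4t)) |λ|/tanh|λ|) dλ`, for `t > 0`. -/
def mehlerKernel {m k : ℕ} (α β : ℝ) (z : EuclideanSpace ℝ (Fin m))
    (σ : EuclideanSpace ℝ (Fin k)) (t : ℝ) : ℂ :=
  ((2 ^ k / (4 * Real.pi * t) ^ β : ℝ) : ℂ) *
    ∫ l : EuclideanSpace ℝ (Fin k), mehlerIntegrand α z σ t l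

/-- The time integral `ℰ_{α,β}(z,σ) = ∫₀^∞ G_{α,β}((z,σ),t) dt`. -/
def mehlerPotential {m k : ℕ} (α β : ℝ) (z : EuclideanSpace ℝ (Fin m))
    (σ : EuclideanSpace ℝ (Fin k)) : ℂ :=
  ∫ t in Set.Ioi (0 : ℝ), mehlerKernel α β z σ t

end

/-! Write `a = |z|²/4`, `d = k`, `p = α + d - 1`. The substitution `τ = 1/t` turns the time integral
into a constant times `∫ τ^(p-1) ∫ e^(-iτ⟨σ,l⟩) (|l|/sinh|l|)^α e^(-τ a |l|/tanh|l|) dl dτ`.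

Let `a > 0`. Fubini allows integrating in `τ` first, which gives a Laplace transform homogeneous of
degree `-p`. Since `p - α = d - 1`, scaling its argument by `sinh|l|/|l|` produces, up to a factor
`cosh|l|`, the Jacobian of `x = (sinh|l|/|l|) l`. What remains is the integral of `e^(-τ(a√(1+|x|²)
+ i⟨σ,x⟩))` against the hyperbolic measure `dx/√(1+|x|²)` and `τ^(p-1) dτ`
(`integral_rpow_mul_integral_mehlerProfile`). Subordination replaces the square root by a mixture of
Gaussians in `x`; integrating in `x`, then `τ`, then `s` leaves Gamma functions and a power of `a² +
|σ|² = N⁴/16` (`hyperboloid_integrable_and_integral`).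

For `a = 0` the double integral is not absolutely convergent, and the formula is reached as a limit
`a → 0`. Dominated convergence needs the inner Fourier integral to be `O(e^(-|σ|τ))` uniformly in
`a` (`exists_norm_mehlerFourier_le`). The product for `sinh` and the partial fractions for `coth`
exhibit the radial profile as a limit of Gaussian mixtures in `|x|`. For one Gaussian the
exponential bound is the arithmetic-geometric mean inequality, and it survives mixtures and limits
(`HasGaussianDecay`). The price is evaluation at `|x|² - 1`, harmless because the singularities in
`w = |x|²` lie at `-(πj)² < -1`. -/

open Set Filter Topology

/-! ### Subordination of `exp (-A √B)` to Gaussians -/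

section Subordination

/-- As `cosh 2y = 1 + 2 sinh² y`, the substitution `x = sinh y` reduces this to a Gaussian. -/
lemma integrable_cosh_mul_exp_neg_mul_cosh {K : ℝ} (hK : 0 < K) :
    Integrable fun y : ℝ => Real.cosh y * Real.exp (-(K * Real.cosh (2 * y))) := by
  have h := integrableOn_image_iff_integrableOn_abs_deriv_smul (s := univ) (f := Real.sinh)
    (f' := Real.cosh) MeasurableSet.univ (fun x _ => (Real.hasDerivAt_sinh x).hasDerivWithinAt)
    Real.sinh_injective.injOn (fun x : ℝ => Real.exp (-K) * Real.exp (-(2 * K) * x ^ 2))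
  rw [image_univ, Real.sinh_surjective.range_eq, integrableOn_univ, integrableOn_univ] at h
  refine (h.1 ((integrable_exp_neg_mul_sq (by positivity)).const_mul _)).congr
    (Eventually.of_forall fun y => ?_)
  simp only [smul_eq_mul, abs_of_pos (Real.cosh_pos y)]
  rw [← Real.exp_add, Real.cosh_two_mul, Real.cosh_sq]
  ring_nf

lemma integral_cosh_mul_exp_neg_mul_cosh (K : ℝ) :
    ∫ y : ℝ, Real.cosh y * Real.exp (-(K * Real.cosh (2 * y))) =
      Real.exp (-K) * √(Real.pi / (2 * K)) := by
  have h := integral_image_eq_integral_abs_deriv_smul (s := univ) (f := Real.sinh)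
    (f' := Real.cosh) MeasurableSet.univ (fun x _ => (Real.hasDerivAt_sinh x).hasDerivWithinAt)
    Real.sinh_injective.injOn (fun x : ℝ => Real.exp (-K) * Real.exp (-(2 * K) * x ^ 2))
  rw [image_univ, Real.sinh_surjective.range_eq, setIntegral_univ, setIntegral_univ,
    integral_const_mul, integral_gaussian] at h
  rw [h]
  refine integral_congr_ae (Eventually.of_forall fun y => ?_)
  simp only [smul_eq_mul, abs_of_pos (Real.cosh_pos y)]
  rw [← Real.exp_add, Real.cosh_two_mul, Real.cosh_sq]
  ring_nf

/-- Averaging over `y ↦ -y` replaces `exp y` by `cosh y`, the other factor being even. -/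
lemma integral_exp_mul_exp_neg_mul_cosh {K : ℝ} (hK : 0 < K) :
    ∫ y : ℝ, Real.exp y * Real.exp (-(K * Real.cosh (2 * y))) =
      Real.exp (-K) * √(Real.pi / (2 * K)) := by
  have hi : Integrable fun y : ℝ => Real.exp y * Real.exp (-(K * Real.cosh (2 * y))) := by
    refine ((integrable_cosh_mul_exp_neg_mul_cosh hK).const_mul 2).mono'
      (by fun_prop) (Eventually.of_forall fun y => ?_)
    rw [Real.norm_of_nonneg (by positivity), ← mul_assoc]
    gcongr
    rw [Real.cosh_eq]
    linarith [Real.exp_pos (-y)]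
  rw [← integral_cosh_mul_exp_neg_mul_cosh K]
  have h1 := integral_neg_eq_self
    (fun y : ℝ => Real.exp y * Real.exp (-(K * Real.cosh (2 * y)))) volume
  have h2 := integral_add hi hi.comp_neg
  rw [h1] at h2
  have h3 : ∫ y : ℝ, Real.cosh y * Real.exp (-(K * Real.cosh (2 * y))) =
      (1 / 2) * ∫ y : ℝ, (Real.exp y * Real.exp (-(K * Real.cosh (2 * y))) +
        Real.exp (-y) * Real.exp (-(K * Real.cosh (2 * -y)))) := by
    rw [← integral_const_mul]
    congr 1 with y
    rw [show 2 * -y = -(2 * y) by ring, Real.cosh_neg, Real.cosh_eq y]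
    ring
  rw [h3, h2]
  ring

/-- The subordination formula, which expresses `exp (-A √B)` as a mixture of the `exp (-s B)`. -/
lemma integral_rpow_neg_half_mul_exp_neg {A B : ℝ} (hA : 0 < A) (hB : 0 < B) :
    ∫ s in Ioi (0 : ℝ), s ^ (-(1 / 2) : ℝ) * Real.exp (-(s * B) - A ^ 2 / (4 * s)) =
      √Real.pi / √B * Real.exp (-(A * √B)) := by
  have hb : 0 < √B := Real.sqrt_pos.2 hB
  have hBb : B = √B ^ 2 := (Real.sq_sqrt hB.le).symm
  set b := √B with hb_def
  -- With `s = c e^(2y)` this choice balances the two terms of the exponent: `sB` and `A²/(4s)`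
  -- become `(Ab/2) e^(2y)` and `(Ab/2) e^(-2y)`, with sum `Ab cosh 2y`.
  set c : ℝ := A / (2 * b) with hc_def
  have hc : 0 < c := by positivity
  have himg : (fun y : ℝ => c * Real.exp (2 * y)) '' univ = Ioi 0 := by
    ext s
    simp only [image_univ, mem_range, mem_Ioi]
    constructor
    · rintro ⟨y, rfl⟩
      positivity
    · intro hs
      refine ⟨Real.log (s / c) / 2, ?_⟩
      rw [mul_div_cancel₀ _ two_ne_zero, Real.exp_log (by positivity)]
      field_simp
  have hder : ∀ y : ℝ, HasDerivAt (fun y : ℝ => c * Real.exp (2 * y))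
      (c * (Real.exp (2 * y) * 2)) y := fun y => by
    have := ((hasDerivAt_id y).const_mul 2).exp.const_mul c
    simpa using this
  have hinj : InjOn (fun y : ℝ => c * Real.exp (2 * y)) univ := by
    intro x _ y _ h
    have := Real.exp_injective (mul_left_cancel₀ hc.ne' h)
    linarith
  rw [← himg, integral_image_eq_integral_abs_deriv_smul MeasurableSet.univ
    (fun x _ => (hder x).hasDerivWithinAt) hinj, setIntegral_univ]
  have hpt : ∀ y : ℝ, |c * (Real.exp (2 * y) * 2)| •
      ((c * Real.exp (2 * y)) ^ (-(1 / 2) : ℝ) *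
        Real.exp (-(c * Real.exp (2 * y) * B) - A ^ 2 / (4 * (c * Real.exp (2 * y))))) =
      (2 * √c) * (Real.exp y * Real.exp (-(A * b * Real.cosh (2 * y)))) := by
    intro y
    rw [abs_of_pos (by positivity), smul_eq_mul, Real.mul_rpow hc.le (Real.exp_pos _).le,
      ← Real.exp_mul, Real.rpow_neg hc.le, ← Real.sqrt_eq_rpow]
    have e1 : -(c * Real.exp (2 * y) * B) - A ^ 2 / (4 * (c * Real.exp (2 * y))) =
        -(A * b * Real.cosh (2 * y)) := by
      rw [hBb, hc_def, Real.cosh_eq, Real.exp_neg]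
      field_simp
      ring
    have e2 : Real.exp (2 * y) * Real.exp (2 * y * -(1 / 2)) = Real.exp y := by
      rw [← Real.exp_add]
      ring_nf
    have e3 : c * (√c)⁻¹ = √c := by
      rw [← div_eq_mul_inv, Real.div_sqrt]
    rw [e1]
    linear_combination (2 * Real.exp (-(A * b * Real.cosh (2 * y)))) *
      (c * (√c)⁻¹ * e2 + Real.exp y * e3)
  simp_rw [hpt]
  rw [integral_const_mul, integral_exp_mul_exp_neg_mul_cosh (by positivity)]
  have e4 : 2 * √c * √(Real.pi / (2 * (A * b))) = √Real.pi / b := by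
    rw [mul_assoc, ← Real.sqrt_mul hc.le,
      show c * (Real.pi / (2 * (A * b))) = Real.pi / (2 * b) ^ 2 by rw [hc_def]; field_simp,
      Real.sqrt_div Real.pi_pos.le, Real.sqrt_sq (by positivity)]
    field_simp
  rw [← e4]
  ring

end Subordination

/-! ### Polar coordinates and the radial change of variables by `sinh` -/

section Radial

variable {V : Type*} [NormedAddCommGroup V] [NormedSpace ℝ V] [FiniteDimensional ℝ V]
  [MeasurableSpace V] [BorelSpace V] [Nontrivial V] (μ : Measure V) [μ.IsAddHaarMeasure]
  {F : Type*} [NormedAddCommGroup F] [NormedSpace ℝ F]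

lemma integral_eq_integral_toSphere_integral_Ioi {f : V → F} (hf : Integrable f μ) :
    ∫ x, f x ∂μ = ∫ ω : Metric.sphere (0 : V) 1, (∫ r in Ioi (0 : ℝ),
      r ^ (Module.finrank ℝ V - 1) • f (r • (ω : V))) ∂μ.toSphere := by
  have hmp := μ.measurePreserving_homeomorphUnitSphereProd
  have hemb := (homeomorphUnitSphereProd V).measurableEmbedding
  have hsymm : ∀ x : ({0}ᶜ : Set V), ((homeomorphUnitSphereProd V x).2 : ℝ) •
      ((homeomorphUnitSphereProd V x).1 : V) = (x : V) := fun x => by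
    have hx : ‖(x : V)‖ ≠ 0 := norm_ne_zero_iff.2 x.2
    simp [smul_smul, hx]
  have hint : Integrable (fun q : Metric.sphere (0 : V) 1 × Ioi (0 : ℝ) => f ((q.2 : ℝ) • (q.1 : V)))
      (μ.toSphere.prod (Measure.volumeIoiPow (Module.finrank ℝ V - 1))) := by
    rw [← hmp.integrable_comp_emb hemb]
    have : (fun q : Metric.sphere (0 : V) 1 × Ioi (0 : ℝ) => f ((q.2 : ℝ) • (q.1 : V))) ∘
        homeomorphUnitSphereProd V = f ∘ Subtype.val := by
      ext x
      simp only [Function.comp_apply, hsymm]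
    rw [this, ← integrableOn_iff_comap_subtypeVal (measurableSet_singleton _).compl]
    exact hf.integrableOn
  calc ∫ x, f x ∂μ = ∫ x : ({0}ᶜ : Set V), f x ∂(μ.comap (↑)) := by
        rw [integral_subtype_comap (measurableSet_singleton _).compl f, restrict_compl_singleton]
    _ = ∫ q : Metric.sphere (0 : V) 1 × Ioi (0 : ℝ), f ((q.2 : ℝ) • (q.1 : V))
          ∂(μ.toSphere.prod (Measure.volumeIoiPow (Module.finrank ℝ V - 1))) := by
        rw [← hmp.integral_comp hemb]
        simp only [hsymm]
    _ = ∫ ω : Metric.sphere (0 : V) 1, (∫ r : Ioi (0 : ℝ), f ((r : ℝ) • (ω : V))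
          ∂(Measure.volumeIoiPow (Module.finrank ℝ V - 1))) ∂μ.toSphere := integral_prod _ hint
    _ = _ := by
        congr 1 with ω
        simp only [Measure.volumeIoiPow, ENNReal.ofReal]
        rw [integral_withDensity_eq_integral_smul
            ((measurable_subtype_coe.pow_const _).real_toNNReal),
          integral_subtype_comap measurableSet_Ioi
            fun a : ℝ ↦ Real.toNNReal (a ^ (Module.finrank ℝ V - 1)) • f (a • (ω : V))]
        refine setIntegral_congr_fun measurableSet_Ioi fun x hx ↦ ?_
        rw [NNReal.smul_def, Real.coe_toNNReal _ (pow_nonneg hx.out.le _)]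

lemma integral_Ioi_eq_integral_cosh_smul_comp_sinh (g : ℝ → F) :
    ∫ y in Ioi (0 : ℝ), g y = ∫ r in Ioi (0 : ℝ), Real.cosh r • g (Real.sinh r) := by
  have himg : Real.sinh '' Ioi 0 = Ioi 0 := by
    ext y
    simp only [mem_image, mem_Ioi]
    constructor
    · rintro ⟨r, hr, rfl⟩
      exact Real.sinh_pos_iff.2 hr
    · intro hy
      exact ⟨Real.arsinh y, Real.arsinh_pos_iff.2 hy, Real.sinh_arsinh y⟩
  conv_lhs => rw [← himg]
  rw [integral_image_eq_integral_abs_deriv_smul measurableSet_Ioi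
    (fun x _ => (Real.hasDerivAt_sinh x).hasDerivWithinAt) Real.sinh_injective.injOn]
  simp only [abs_of_pos (Real.cosh_pos _)]

/-- The change of variables `x = (sinh |l| / |l|) l`, which maps geodesic normal coordinates of
hyperbolic space to the linear coordinates of the hyperboloid model. -/
lemma integral_eq_integral_sinh_div_smul {f : V → F} (hf : Integrable f μ)
    (hg : Integrable (fun l : V => ((Real.sinh ‖l‖ / ‖l‖) ^ (Module.finrank ℝ V - 1) *
      Real.cosh ‖l‖) • f ((Real.sinh ‖l‖ / ‖l‖) • l)) μ) :
    ∫ x, f x ∂μ = ∫ l : V, ((Real.sinh ‖l‖ / ‖l‖) ^ (Module.finrank ℝ V - 1) *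
      Real.cosh ‖l‖) • f ((Real.sinh ‖l‖ / ‖l‖) • l) ∂μ := by
  rw [integral_eq_integral_toSphere_integral_Ioi μ hf,
    integral_eq_integral_toSphere_integral_Ioi μ hg]
  congr 1 with ω
  rw [integral_Ioi_eq_integral_cosh_smul_comp_sinh]
  refine setIntegral_congr_fun measurableSet_Ioi fun r hr => ?_
  have hr : 0 < r := hr
  have hω : ‖(ω : V)‖ = 1 := by simp
  simp only [norm_smul, hω, mul_one, Real.norm_of_nonneg hr.le, smul_smul]
  rw [div_mul_cancel₀ _ hr.ne', div_pow]
  congr 1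
  field_simp

end Radial

/-! ### The integral over the hyperboloid -/

section Hyperboloid

lemma integrableOn_rpow_mul_exp_neg_const_mul_sq {q b : ℝ} (hq : -1 < q) (hb : 0 < b) :
    IntegrableOn (fun x : ℝ => x ^ q * Real.exp (-(b * x ^ 2))) (Ioi 0) := by
  have := integrableOn_rpow_mul_exp_neg_mul_rpow hq two_pos hb
  simpa only [Real.rpow_two, neg_mul] using this

lemma integral_rpow_mul_exp_neg_const_mul_sq {q b : ℝ} (hq : -1 < q) (hb : 0 < b) :
    ∫ x in Ioi (0 : ℝ), x ^ q * Real.exp (-(b * x ^ 2)) =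
      b ^ (-(q + 1) / 2) * (1 / 2) * Real.Gamma ((q + 1) / 2) := by
  have := integral_rpow_mul_exp_neg_mul_rpow two_pos hq hb
  simpa only [Real.rpow_two, neg_mul] using this

/-- With `p = α + d - 1` and `D = a² + |σ|²`, the product of this number and `Γ(α / 2) / √π` is the
value of `∫ τ ^ (p - 1) ∫ (1 + |x|²) ^ (-1/2) exp (-τ (a √(1 + |x|²) + i⟨σ, x⟩)) dx dτ` on a space of
dimension `d`. -/
noncomputable def hyperboloidConst (α d D : ℝ) : ℝ :=
  (1 / 2) * Real.Gamma ((α + d - 1) / 2) * 4 ^ ((α + d - 1) / 2) * D ^ (-((α + d - 1) / 2)) *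
    Real.pi ^ (d / 2)

/-- The `x`-integral contributes `s^(-d/2)` and the `τ`-integral `s^((α+d-1)/2)`; together with
`s^(-1/2)` the dimension cancels and the integrand of `Γ(α/2)` remains. -/
lemma gaussian_moment_eq {α d D s : ℝ} (hD : 0 < D) (hs : 0 < s) :
    s ^ (-(1 / 2) : ℝ) * Real.exp (-s) * ((Real.pi / s) ^ (d / 2) *
      ((D / (4 * s)) ^ (-(α + d - 1 - 1 + 1) / 2) * (1 / 2) *
        Real.Gamma ((α + d - 1 - 1 + 1) / 2))) =
    hyperboloidConst α d D * (Real.exp (-s) * s ^ (α / 2 - 1)) := by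
  unfold hyperboloidConst
  rw [sub_add_cancel, Real.div_rpow Real.pi_pos.le hs.le, Real.div_rpow hD.le (by positivity),
    Real.mul_rpow (by norm_num) hs.le, neg_div, Real.rpow_neg (by norm_num : (0 : ℝ) ≤ 4),
    Real.rpow_neg hs.le ((α + d - 1) / 2)]
  have : s ^ (α / 2 - 1) = s ^ (-(1 / 2) : ℝ) / s ^ (d / 2) * s ^ ((α + d - 1) / 2) := by
    rw [← Real.rpow_sub hs, ← Real.rpow_add hs]
    ring_nf
  rw [this]
  field_simp

variable {V : Type*} [NormedAddCommGroup V] [InnerProductSpace ℝ V] [FiniteDimensional ℝ V]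
  [MeasurableSpace V] [BorelSpace V]

local notation "dim" => Module.finrank ℝ V

lemma integrable_exp_neg_mul_sq_norm {b : ℝ} (hb : 0 < b) :
    Integrable fun x : V => Real.exp (-(b * ‖x‖ ^ 2)) := by
  have h := (GaussianFourier.integrable_cexp_neg_mul_sq_norm_add (b := (b : ℂ)) (V := V) (by simpa using hb) 0 0).norm
  refine h.congr (Eventually.of_forall fun x => ?_)
  simp only [Complex.norm_exp]
  norm_cast
  simp

lemma integral_exp_neg_mul_sq_norm {b : ℝ} (hb : 0 < b) :
    ∫ x : V, Real.exp (-(b * ‖x‖ ^ 2)) = (Real.pi / b) ^ ((dim : ℝ) / 2) := by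
  rw [← GaussianFourier.integral_rexp_neg_mul_sq_norm hb]
  simp only [neg_mul]

lemma integral_cexp_inner_mul_exp_neg_mul_sq_norm {b : ℝ} (hb : 0 < b) (ξ : V) :
    ∫ x : V, Complex.exp (-Complex.I * (inner ℝ ξ x : ℝ)) * (Real.exp (-(b * ‖x‖ ^ 2)) : ℝ) =
      (((Real.pi / b) ^ ((dim : ℝ) / 2) * Real.exp (-(‖ξ‖ ^ 2 / (4 * b))) : ℝ) : ℂ) := by
  have h := GaussianFourier.integral_cexp_neg_mul_sq_norm_add (b := (b : ℂ)) (V := V)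
    (by simpa using hb) (-Complex.I) ξ
  push_cast
  rw [Complex.ofReal_cpow (by positivity)]
  push_cast
  rw [show -((‖ξ‖ : ℂ) ^ 2 / (4 * (b : ℂ))) = (-Complex.I) ^ 2 * (‖ξ‖ : ℂ) ^ 2 / (4 * b) by
    rw [neg_sq, Complex.I_sq]; ring, ← h]
  congr 1 with x
  rw [← Complex.exp_add]
  ring_nf

/-- The modulus of the integrand on `V × (0, ∞) × (0, ∞)` is integrable. -/
lemma integrable_hyperboloid_majorant {α a : ℝ} (hα : 0 < α) (ha : 0 < a) (hp : 0 < α + dim - 1) :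
    Integrable (fun q : (V × ℝ) × ℝ => q.1.2 ^ (α + dim - 1 - 1) * (q.2 ^ (-(1 / 2) : ℝ) *
      Real.exp (-(q.2 * (1 + ‖q.1.1‖ ^ 2)) - (q.1.2 * a) ^ 2 / (4 * q.2))))
      ((volume.prod (volume.restrict (Ioi 0))).prod (volume.restrict (Ioi 0))) := by
  have hmeas : AEStronglyMeasurable (fun q : (V × ℝ) × ℝ => q.1.2 ^ (α + dim - 1 - 1) *
      (q.2 ^ (-(1 / 2) : ℝ) *
      Real.exp (-(q.2 * (1 + ‖q.1.1‖ ^ 2)) - (q.1.2 * a) ^ 2 / (4 * q.2))))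
      ((volume.prod (volume.restrict (Ioi 0))).prod (volume.restrict (Ioi 0))) := by
    apply Measurable.aestronglyMeasurable
    fun_prop
  have hfac : ∀ s ∈ Ioi (0 : ℝ), ∀ q : V × ℝ, q.2 ^ (α + dim - 1 - 1) * (s ^ (-(1 / 2) : ℝ) *
      Real.exp (-(s * (1 + ‖q.1‖ ^ 2)) - (q.2 * a) ^ 2 / (4 * s))) =
      s ^ (-(1 / 2) : ℝ) * Real.exp (-s) * (Real.exp (-(s * ‖q.1‖ ^ 2)) *
        (q.2 ^ (α + dim - 1 - 1) * Real.exp (-(a ^ 2 / (4 * s) * q.2 ^ 2)))) := by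
    intro s hs q
    have : Real.exp (-(s * (1 + ‖q.1‖ ^ 2)) - (q.2 * a) ^ 2 / (4 * s)) =
        Real.exp (-s) * Real.exp (-(s * ‖q.1‖ ^ 2)) * Real.exp (-(a ^ 2 / (4 * s) * q.2 ^ 2)) := by
      rw [← Real.exp_add, ← Real.exp_add]
      ring_nf
    rw [this]
    ring
  refine (integrable_prod_iff' hmeas).2 ⟨?_, ?_⟩
  · filter_upwards [ae_restrict_mem measurableSet_Ioi] with s hs
    have hs' : (0 : ℝ) < s := hs
    simp only [hfac s hs]
    exact ((integrable_exp_neg_mul_sq_norm hs').mul_prod (integrableOn_rpow_mul_exp_neg_const_mul_sq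
      (q := α + dim - 1 - 1) (b := a ^ 2 / (4 * s)) (by linarith) (by positivity))).const_mul _
  -- The integral of the modulus at fixed `s` is the same Gaussian moment without oscillation, that
  -- is, with `D = a²`.
  · have hG : IntegrableOn (fun s : ℝ => hyperboloidConst α dim (a ^ 2) *
        (Real.exp (-s) * s ^ (α / 2 - 1))) (Ioi 0) :=
      (Real.GammaIntegral_convergent (half_pos hα)).const_mul _
    refine hG.congr ?_
    filter_upwards [ae_restrict_mem measurableSet_Ioi] with s hs
    have hs' : (0 : ℝ) < s := hs
    rw [← gaussian_moment_eq (by positivity) hs', ← integral_exp_neg_mul_sq_norm hs',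
      ← integral_rpow_mul_exp_neg_const_mul_sq (by linarith) (by positivity), ← integral_prod_mul,
      ← integral_const_mul]
    refine integral_congr_ae ?_
    have : ∀ᵐ q : V × ℝ ∂(volume.prod (volume.restrict (Ioi 0))), q.2 ∈ Ioi (0 : ℝ) :=
      Measure.quasiMeasurePreserving_snd.ae (ae_restrict_mem measurableSet_Ioi)
    filter_upwards [this] with q hq
    have hq' : (0 : ℝ) < q.2 := hq
    rw [Real.norm_of_nonneg (by positivity), ← hfac s hs]

/-- Integrating `T` in `s` gives the stated integrand times `√π` by subordination. Integrating it in
`x` instead gives a Gaussian in `τσ`, whose exponent merges with `(τa)²/(4s)` so that only `a² +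
‖σ‖²` survives. Fubini equates the two orders. -/
lemma hyperboloid_integrable_and_integral {α a : ℝ} (hα : 0 < α) (ha : 0 < a)
    (hp : 0 < α + dim - 1) (σ : V) :
    Integrable (fun q : V × ℝ => ((q.2 ^ (α + dim - 1 - 1) / √(1 + ‖q.1‖ ^ 2) : ℝ) : ℂ) *
      Complex.exp (-q.2 * (a * √(1 + ‖q.1‖ ^ 2) + Complex.I * (inner ℝ σ q.1 : ℝ))))
      (volume.prod (volume.restrict (Ioi 0))) ∧
    ∫ q : V × ℝ, ((q.2 ^ (α + dim - 1 - 1) / √(1 + ‖q.1‖ ^ 2) : ℝ) : ℂ) *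
      Complex.exp (-q.2 * (a * √(1 + ‖q.1‖ ^ 2) + Complex.I * (inner ℝ σ q.1 : ℝ)))
      ∂(volume.prod (volume.restrict (Ioi 0))) =
    ((hyperboloidConst α dim (a ^ 2 + ‖σ‖ ^ 2) * Real.Gamma (α / 2) / √Real.pi : ℝ) : ℂ) := by
  set T : (V × ℝ) × ℝ → ℂ := fun q =>
    Complex.exp (-Complex.I * (inner ℝ (q.1.2 • σ) q.1.1 : ℝ)) *
    ((q.1.2 ^ (α + dim - 1 - 1) * (q.2 ^ (-(1 / 2) : ℝ) *
      Real.exp (-(q.2 * (1 + ‖q.1.1‖ ^ 2)) - (q.1.2 * a) ^ 2 / (4 * q.2))) : ℝ) : ℂ) with hT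
  have hTi : Integrable T ((volume.prod (volume.restrict (Ioi 0))).prod
      (volume.restrict (Ioi 0))) := by
    refine ((integrable_hyperboloid_majorant (V := V) hα ha hp).ofReal (𝕜 := ℂ)).bdd_mul (c := 1)
      (Continuous.aestronglyMeasurable (by fun_prop)) (Eventually.of_forall fun q => ?_)
    rw [show -Complex.I * ((inner ℝ (q.1.2 • σ) q.1.1 : ℝ) : ℂ) =
      ((-(inner ℝ (q.1.2 • σ) q.1.1) : ℝ) : ℂ) * Complex.I by push_cast; ring,
      Complex.norm_exp_ofReal_mul_I]
  have hpos : ∀ᵐ q : V × ℝ ∂(volume.prod (volume.restrict (Ioi 0))), q.2 ∈ Ioi (0 : ℝ) :=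
    Measure.quasiMeasurePreserving_snd.ae (ae_restrict_mem measurableSet_Ioi)
  have hs_int : ∀ q : V × ℝ, q.2 ∈ Ioi (0 : ℝ) → ∫ s in Ioi (0 : ℝ), T (q, s) =
      (√Real.pi : ℝ) * (((q.2 ^ (α + dim - 1 - 1) / √(1 + ‖q.1‖ ^ 2) : ℝ) : ℂ) *
      Complex.exp (-q.2 * (a * √(1 + ‖q.1‖ ^ 2) + Complex.I * (inner ℝ σ q.1 : ℝ)))) := by
    intro q hq
    have hq' : (0 : ℝ) < q.2 := hq
    simp only [hT]
    rw [integral_const_mul]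
    rw [integral_complex_ofReal, integral_const_mul,
      integral_rpow_neg_half_mul_exp_neg (by positivity) (by positivity)]
    have : Complex.exp (-q.2 * (a * √(1 + ‖q.1‖ ^ 2) + Complex.I * (inner ℝ σ q.1 : ℝ))) =
        Complex.exp (-Complex.I * (inner ℝ (q.2 • σ) q.1 : ℝ)) *
        (Real.exp (-(q.2 * a * √(1 + ‖q.1‖ ^ 2))) : ℝ) := by
      rw [inner_smul_left]
      push_cast
      rw [← Complex.exp_add]
      congr 1
      simp
      ring
    rw [this]
    push_cast
    ring
  have hπ : ((√Real.pi : ℝ) : ℂ) ≠ 0 := by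
    exact_mod_cast (Real.sqrt_pos.2 Real.pi_pos).ne'
  have hq_int : ∀ᵐ s ∂(volume.restrict (Ioi (0 : ℝ))), ∫ q : V × ℝ, T (q, s) ∂(volume.prod (volume.restrict (Ioi 0))) =
      ((hyperboloidConst α dim (a ^ 2 + ‖σ‖ ^ 2) * (Real.exp (-s) * s ^ (α / 2 - 1)) : ℝ) : ℂ) := by
    filter_upwards [ae_restrict_mem measurableSet_Ioi, hTi.prod_left_ae] with s hs hsi
    have hs' : (0 : ℝ) < s := hs
    have hx : ∀ τ : ℝ, ∫ x : V, T ((x, τ), s) =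
        ((s ^ (-(1 / 2) : ℝ) * Real.exp (-s) * ((Real.pi / s) ^ ((dim : ℝ) / 2) *
          (τ ^ (α + dim - 1 - 1) * Real.exp (-((a ^ 2 + ‖σ‖ ^ 2) / (4 * s) * τ ^ 2)))) : ℝ) : ℂ) := by
      intro τ
      have hsplit : ∀ x : V, T ((x, τ), s) = ((τ ^ (α + dim - 1 - 1) * s ^ (-(1 / 2) : ℝ) *
          (Real.exp (-s) * Real.exp (-(a ^ 2 / (4 * s) * τ ^ 2))) : ℝ) : ℂ) *
          (Complex.exp (-Complex.I * (inner ℝ (τ • σ) x : ℝ)) *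
            (Real.exp (-(s * ‖x‖ ^ 2)) : ℝ)) := by
        intro x
        have : Real.exp (-(s * (1 + ‖x‖ ^ 2)) - (τ * a) ^ 2 / (4 * s)) =
            Real.exp (-s) * Real.exp (-(a ^ 2 / (4 * s) * τ ^ 2)) * Real.exp (-(s * ‖x‖ ^ 2)) := by
          rw [← Real.exp_add, ← Real.exp_add]
          ring_nf
        simp only [hT]
        rw [this]
        push_cast
        ring
      have hexp : Real.exp (-((a ^ 2 + ‖σ‖ ^ 2) / (4 * s) * τ ^ 2)) =
          Real.exp (-(a ^ 2 / (4 * s) * τ ^ 2)) * Real.exp (-(‖τ • σ‖ ^ 2 / (4 * s))) := by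
        rw [← Real.exp_add, norm_smul, mul_pow, Real.norm_eq_abs, sq_abs]
        ring_nf
      simp_rw [hsplit]
      rw [integral_const_mul, integral_cexp_inner_mul_exp_neg_mul_sq_norm hs', hexp]
      push_cast
      ring
    have hD : 0 < a ^ 2 + ‖σ‖ ^ 2 := by positivity
    rw [integral_prod_symm _ hsi]
    simp_rw [hx]
    rw [integral_complex_ofReal, integral_const_mul, integral_const_mul,
      integral_rpow_mul_exp_neg_const_mul_sq (by linarith) (by positivity),
      gaussian_moment_eq hD hs']
  have hswap := integral_integral_swap (f := fun q s => T (q, s)) hTi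
  have hleft := hTi.integral_prod_left
  constructor
  · have := hleft.const_mul (((√Real.pi : ℝ) : ℂ)⁻¹)
    refine this.congr ?_
    filter_upwards [hpos] with q hq
    rw [hs_int q hq, inv_mul_cancel_left₀ hπ]
  · rw [integral_congr_ae (hpos.mono fun q hq => hs_int q hq), integral_const_mul,
      integral_congr_ae hq_int, integral_complex_ofReal, integral_const_mul,
      ← Real.Gamma_eq_integral (half_pos hα)] at hswap
    rw [Complex.ofReal_div, eq_div_iff hπ, ← hswap]
    ring

end Hyperboloid

/-! ### The radial profile, and the potential for `a > 0` -/

section Profile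

lemma sinh_le_self_mul_cosh {r : ℝ} (hr : 0 ≤ r) : Real.sinh r ≤ r * Real.cosh r := by
  have hmono : MonotoneOn (fun x : ℝ => x * Real.cosh x - Real.sinh x) (Ici 0) := by
    refine monotoneOn_of_deriv_nonneg (convex_Ici 0) (by fun_prop) (by fun_prop) fun x hx => ?_
    have hx0 : 0 < x := by simpa using hx
    have hd : HasDerivAt (fun x : ℝ => x * Real.cosh x - Real.sinh x)
        (1 * Real.cosh x + x * Real.sinh x - Real.cosh x) x :=
      ((hasDerivAt_id x).mul (Real.hasDerivAt_cosh x)).sub (Real.hasDerivAt_sinh x)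
    rw [hd.deriv]
    have := mul_nonneg hx0.le (Real.sinh_nonneg_iff.2 hx0.le)
    linarith
  have := hmono (mem_Ici.2 le_rfl) hr hr
  simp at this
  linarith

lemma one_le_div_tanh {r : ℝ} (hr : 0 < r) : 1 ≤ r / Real.tanh r := by
  have hs := Real.sinh_pos_iff.2 hr
  rw [Real.tanh_eq_sinh_div_cosh, div_div_eq_mul_div, le_div_iff₀ hs, one_mul]
  exact sinh_le_self_mul_cosh hr.le

/-- The radial factor `(r / sinh r) ^ α exp (-A r / tanh r)` of the Mehler kernel. -/
noncomputable def mehlerProfile (α A r : ℝ) : ℝ :=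
  (r / Real.sinh r) ^ α * Real.exp (-A * (r / Real.tanh r))

lemma div_sinh_nonneg {r : ℝ} (hr : 0 ≤ r) : 0 ≤ r / Real.sinh r :=
  div_nonneg hr (Real.sinh_nonneg_iff.2 hr)

lemma mehlerProfile_nonneg (α A : ℝ) {r : ℝ} (hr : 0 ≤ r) : 0 ≤ mehlerProfile α A r :=
  mul_nonneg (Real.rpow_nonneg (div_sinh_nonneg hr) _) (Real.exp_pos _).le

/-- Since `r / tanh r ≥ 1`, a factor `exp (-A)` can be extracted; with `A = τ a` it supplies the
decay in `τ` that Fubini requires. -/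
lemma mehlerProfile_le_mul_exp_neg (α : ℝ) {A r : ℝ} (hA : 0 ≤ A) (hr : 0 < r) :
    mehlerProfile α A r ≤ (r / Real.sinh r) ^ α * Real.exp (-A) := by
  unfold mehlerProfile
  have := one_le_div_tanh hr
  gcongr
  nlinarith

@[fun_prop]
lemma measurable_tanh : Measurable Real.tanh := by
  simp_rw [funext Real.tanh_eq_sinh_div_cosh]
  exact Real.measurable_sinh.div Real.measurable_cosh

lemma measurable_mehlerProfile (α : ℝ) : Measurable fun q : ℝ × ℝ => mehlerProfile α q.1 q.2 := by
  unfold mehlerProfile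
  fun_prop

/-- The Laplace transform of `τ ^ (p - 1)`. -/
noncomputable def laplaceRpow (p : ℝ) (w : ℂ) : ℂ :=
  ∫ τ in Ioi (0 : ℝ), ((τ ^ (p - 1) : ℝ) : ℂ) * Complex.exp (-τ * w)

lemma laplaceRpow_mul (p : ℝ) {c : ℝ} (hc : 0 < c) (w : ℂ) :
    laplaceRpow p (c * w) = ((c ^ (-p) : ℝ) : ℂ) * laplaceRpow p w := by
  have h := integral_comp_mul_left_Ioi
    (fun τ : ℝ => ((τ ^ (p - 1) : ℝ) : ℂ) * Complex.exp (-τ * w)) 0 hc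
  have h2 : ∀ τ ∈ Ioi (0 : ℝ), (((c * τ) ^ (p - 1) : ℝ) : ℂ) * Complex.exp (-(c * τ : ℝ) * w) =
      ((c ^ (p - 1) : ℝ) : ℂ) * (((τ ^ (p - 1) : ℝ) : ℂ) * Complex.exp (-τ * (c * w))) := by
    intro τ hτ
    rw [Real.mul_rpow hc.le (le_of_lt hτ)]
    push_cast
    ring_nf
  rw [setIntegral_congr_fun measurableSet_Ioi h2, integral_const_mul, mul_zero, Complex.real_smul] at h
  have hc1 : ((c ^ (p - 1) : ℝ) : ℂ) ≠ 0 := by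
    exact_mod_cast (Real.rpow_pos_of_pos hc _).ne'
  have hc2 : ((c ^ (-p) : ℝ) : ℂ) = ((c ^ (p - 1) : ℝ) : ℂ)⁻¹ * ((c⁻¹ : ℝ) : ℂ) := by
    rw [← Complex.ofReal_inv, ← Complex.ofReal_mul, ← Real.rpow_neg hc.le, ← Real.rpow_neg_one c,
      ← Real.rpow_add hc]
    ring_nf
  rw [hc2, laplaceRpow, laplaceRpow, mul_assoc, ← h,
    inv_mul_cancel_left₀ hc1]

variable {V : Type*} [NormedAddCommGroup V] [InnerProductSpace ℝ V] [FiniteDimensional ℝ V]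
  [MeasurableSpace V] [BorelSpace V]

local notation "dim" => Module.finrank ℝ V

lemma norm_cexp_neg_I_mul (x : ℝ) : ‖Complex.exp (-Complex.I * (x : ℂ))‖ = 1 := by
  rw [show -Complex.I * (x : ℂ) = ((-x : ℝ) : ℂ) * Complex.I by push_cast; ring,
    Complex.norm_exp_ofReal_mul_I]

lemma ae_norm_pos [Nontrivial V] : ∀ᵐ l : V, 0 < ‖l‖ := by
  filter_upwards [compl_mem_ae_iff.2 (measure_singleton (0 : V))] with l hl
  exact norm_pos_iff.2 hl

lemma ae_prod_norm_pos_and_pos [Nontrivial V] :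
    ∀ᵐ q : V × ℝ ∂(volume.prod (volume.restrict (Ioi 0))), 0 < ‖q.1‖ ∧ 0 < q.2 := by
  have h2 : ∀ᵐ q : V × ℝ ∂(volume.prod (volume.restrict (Ioi 0))), q.2 ∈ Ioi (0 : ℝ) :=
    Measure.quasiMeasurePreserving_snd.ae (ae_restrict_mem measurableSet_Ioi)
  have h1 : ∀ᵐ q : V × ℝ ∂(volume.prod (volume.restrict (Ioi 0))), 0 < ‖q.1‖ :=
    Measure.quasiMeasurePreserving_fst.ae ae_norm_pos
  exact h1.and h2

lemma integrable_prod_mehlerProfile [Nontrivial V] {α a p : ℝ} (ha : 0 < a) (hp : 0 < p)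
    (hF : Integrable fun l : V => (‖l‖ / Real.sinh ‖l‖) ^ α) (σ : V) :
    Integrable (fun q : V × ℝ => ((q.2 ^ (p - 1) : ℝ) : ℂ) *
      (Complex.exp (-Complex.I * ((q.2 * inner ℝ σ q.1 : ℝ) : ℂ)) *
        (mehlerProfile α (q.2 * a) ‖q.1‖ : ℝ))) (volume.prod (volume.restrict (Ioi 0))) := by
  have hτ : IntegrableOn (fun τ : ℝ => τ ^ (p - 1) * Real.exp (-(a * τ))) (Ioi 0) := by
    have := integrableOn_rpow_mul_exp_neg_mul_rpow (s := p - 1) (p := 1) (by linarith) one_pos ha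
    simpa only [Real.rpow_one, neg_mul] using this
  refine (hF.mul_prod hτ).mono' ?_ ?_
  · refine Measurable.aestronglyMeasurable ?_
    have := (measurable_mehlerProfile α).comp
      (f := fun q : V × ℝ => (q.2 * a, ‖q.1‖)) (by fun_prop)
    have : Measurable fun q : V × ℝ => mehlerProfile α (q.2 * a) ‖q.1‖ := this
    fun_prop
  · filter_upwards [ae_prod_norm_pos_and_pos] with q hq
    obtain ⟨h1, h2⟩ := hq
    rw [norm_mul, norm_mul, norm_cexp_neg_I_mul, one_mul, Complex.norm_real, Complex.norm_real,
      Real.norm_of_nonneg (by positivity), Real.norm_of_nonneg (mehlerProfile_nonneg _ _ h1.le)]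
    have := mehlerProfile_le_mul_exp_neg α (mul_pos h2 ha).le h1
    calc _ ≤ q.2 ^ (p - 1) * ((‖q.1‖ / Real.sinh ‖q.1‖) ^ α * Real.exp (-(q.2 * a))) := by gcongr
      _ = _ := by rw [mul_comm q.2 a]; ring

/-- After Fubini, the `τ`-integral at `l` is the hyperboloid integrand `f` at `(sinh|l|/|l|) l`
times the Jacobian, by homogeneity of the Laplace transform. -/
lemma integral_rpow_mul_integral_mehlerProfile [Nontrivial V] {α a : ℝ} (hα : 0 < α) (ha : 0 < a)
    (hF : Integrable fun l : V => (‖l‖ / Real.sinh ‖l‖) ^ α) (σ : V) :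
    ∫ τ in Ioi (0 : ℝ), ((τ ^ (α + dim - 1 - 1) : ℝ) : ℂ) *
      ∫ l : V, Complex.exp (-Complex.I * ((τ * inner ℝ σ l : ℝ) : ℂ)) *
        (mehlerProfile α (τ * a) ‖l‖ : ℝ) =
    ((hyperboloidConst α dim (a ^ 2 + ‖σ‖ ^ 2) * Real.Gamma (α / 2) / √Real.pi : ℝ) : ℂ) := by
  have hd : (1 : ℝ) ≤ (dim : ℝ) := by exact_mod_cast Module.finrank_pos (R := ℝ) (M := V)
  have hp : 0 < α + dim - 1 := by linarith
  set p := α + dim - 1 with hp_def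
  obtain ⟨hint, hval⟩ := hyperboloid_integrable_and_integral hα ha hp σ
  set f : V → ℂ := fun x => (((1 / √(1 + ‖x‖ ^ 2) : ℝ)) : ℂ) *
    laplaceRpow p (a * √(1 + ‖x‖ ^ 2) + Complex.I * (inner ℝ σ x : ℝ)) with hf_def
  have hinner : ∀ x : V, ∫ τ in Ioi (0 : ℝ), ((τ ^ (p - 1) / √(1 + ‖x‖ ^ 2) : ℝ) : ℂ) *
      Complex.exp (-τ * (a * √(1 + ‖x‖ ^ 2) + Complex.I * (inner ℝ σ x : ℝ))) = f x := by
    intro x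
    simp only [hf_def, laplaceRpow]
    rw [← integral_const_mul]
    congr 1 with τ
    push_cast
    ring
  have hfi : Integrable f := (hint.integral_prod_left).congr (Eventually.of_forall hinner)
  have hfval : ∫ x, f x = ((hyperboloidConst α dim (a ^ 2 + ‖σ‖ ^ 2) * Real.Gamma (α / 2) /
      √Real.pi : ℝ) : ℂ) := by
    rw [← hval, integral_prod _ hint]
    exact integral_congr_ae (Eventually.of_forall fun x => (hinner x).symm)
  have hh := integrable_prod_mehlerProfile (V := V) ha hp hF σ
  have hhinner : ∀ l : V, 0 < ‖l‖ → ∫ τ in Ioi (0 : ℝ), ((τ ^ (p - 1) : ℝ) : ℂ) *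
      (Complex.exp (-Complex.I * ((τ * inner ℝ σ l : ℝ) : ℂ)) *
        (mehlerProfile α (τ * a) ‖l‖ : ℝ)) =
      ((Real.sinh ‖l‖ / ‖l‖) ^ (dim - 1) * Real.cosh ‖l‖) • f ((Real.sinh ‖l‖ / ‖l‖) • l) := by
    intro l hl
    set r := ‖l‖ with hr
    have hs : 0 < Real.sinh r := Real.sinh_pos_iff.2 hl
    have hc : 0 < Real.cosh r := Real.cosh_pos r
    have hq : 0 < Real.sinh r / r := by positivity
    have hnorm : √(1 + ‖(Real.sinh r / r) • l‖ ^ 2) = Real.cosh r := by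
      rw [norm_smul, Real.norm_of_nonneg hq.le, ← hr, div_mul_cancel₀ _ hl.ne', add_comm,
        ← Real.cosh_sq, Real.sqrt_sq hc.le]
    have harg : (a : ℂ) * (Real.cosh r : ℝ) + Complex.I *
        ((inner ℝ σ ((Real.sinh r / r) • l) : ℝ) : ℂ) = ((Real.sinh r / r : ℝ) : ℂ) *
        (((a * (r / Real.tanh r) : ℝ) : ℂ) + Complex.I * (inner ℝ σ l : ℝ)) := by
      have : a * Real.cosh r = Real.sinh r / r * (a * (r / Real.tanh r)) := by
        rw [Real.tanh_eq_sinh_div_cosh]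
        field_simp
      rw [inner_smul_right, ← Complex.ofReal_mul, this]
      push_cast
      ring
    -- This is where the exponent `p = α + dim - 1` is forced: `(dim - 1) - p = -α`.
    have hpow : (Real.sinh r / r) ^ (dim - 1) * (Real.sinh r / r) ^ (-p) =
        (r / Real.sinh r) ^ α := by
      rw [← Real.rpow_natCast, ← Real.rpow_add hq, Nat.cast_sub (by exact_mod_cast hd), hp_def,
        ← inv_div (Real.sinh r) r, Real.inv_rpow hq.le, ← Real.rpow_neg hq.le]
      congr 1
      push_cast
      ring
    simp only [hf_def]
    rw [hnorm, harg, laplaceRpow_mul p hq, Complex.real_smul, laplaceRpow]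
    rw [show (((Real.sinh r / r) ^ (dim - 1) * Real.cosh r : ℝ) : ℂ) *
      (((1 / Real.cosh r : ℝ) : ℂ) * ((((Real.sinh r / r) ^ (-p) : ℝ) : ℂ) *
      ∫ τ in Ioi (0 : ℝ), ((τ ^ (p - 1) : ℝ) : ℂ) * Complex.exp (-τ *
        (((a * (r / Real.tanh r) : ℝ) : ℂ) + Complex.I * (inner ℝ σ l : ℝ))))) =
      (((r / Real.sinh r) ^ α : ℝ) : ℂ) *
      ∫ τ in Ioi (0 : ℝ), ((τ ^ (p - 1) : ℝ) : ℂ) * Complex.exp (-τ *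
        (((a * (r / Real.tanh r) : ℝ) : ℂ) + Complex.I * (inner ℝ σ l : ℝ))) by
      rw [← hpow, ← mul_assoc, ← mul_assoc, ← Complex.ofReal_mul, ← Complex.ofReal_mul]
      congr 3
      field_simp, ← integral_const_mul]
    congr 1 with τ
    have : Complex.exp (-τ * (((a * (r / Real.tanh r) : ℝ) : ℂ) + Complex.I * (inner ℝ σ l : ℝ))) =
        Complex.exp (-Complex.I * ((τ * inner ℝ σ l : ℝ) : ℂ)) *
        ((Real.exp (-(τ * a) * (r / Real.tanh r)) : ℝ) : ℂ) := by
      push_cast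
      rw [← Complex.exp_add]
      congr 1
      ring
    rw [this, mehlerProfile]
    push_cast
    ring
  have hhae : (fun l : V => ∫ τ in Ioi (0 : ℝ), ((τ ^ (p - 1) : ℝ) : ℂ) *
      (Complex.exp (-Complex.I * ((τ * inner ℝ σ l : ℝ) : ℂ)) *
        (mehlerProfile α (τ * a) ‖l‖ : ℝ))) =ᵐ[volume] fun l =>
      ((Real.sinh ‖l‖ / ‖l‖) ^ (dim - 1) * Real.cosh ‖l‖) • f ((Real.sinh ‖l‖ / ‖l‖) • l) :=
    ae_norm_pos.mono hhinner
  have hswap := integral_integral_swap (f := fun (l : V) (τ : ℝ) => ((τ ^ (p - 1) : ℝ) : ℂ) *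
      (Complex.exp (-Complex.I * ((τ * inner ℝ σ l : ℝ) : ℂ)) *
        (mehlerProfile α (τ * a) ‖l‖ : ℝ))) hh
  rw [integral_congr_ae hhae, ← integral_eq_integral_sinh_div_smul volume hfi
    (hh.integral_prod_left.congr hhae), hfval] at hswap
  rw [hswap]
  simp_rw [integral_const_mul]

end Profile

/-! ### Exponential decay of Fourier transforms of Gaussian mixtures -/

section GaussianMixtures

variable {V : Type*} [NormedAddCommGroup V] [InnerProductSpace ℝ V] [FiniteDimensional ℝ V]
  [MeasurableSpace V] [BorelSpace V]

/-- A bounded nonnegative function `g` on `[-1, ∞)` has Gaussian decay bounds on `V` if the Fourier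
transform of `g(|x|²) exp (-δ|x|²)` at `ξ` is at most `exp (-|ξ|)` times the integral of the same
expression with `|x|²` replaced by `|x|² - 1`.  For the Laplace transform `g` of a positive measure
this amounts to shifting the contour of integration by a unit imaginary vector. -/
structure HasGaussianDecay (V : Type*) [NormedAddCommGroup V] [InnerProductSpace ℝ V]
    [FiniteDimensional ℝ V] [MeasurableSpace V] [BorelSpace V] (g : ℝ → ℝ) : Prop where
  measurable : Measurable g
  nonneg : ∀ w, -1 ≤ w → 0 ≤ g w
  bdd : ∃ B, ∀ w, -1 ≤ w → g w ≤ B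
  norm_integral_le : ∀ δ > 0, ∀ ξ : V,
    ‖∫ x : V, Complex.exp (-Complex.I * (inner ℝ ξ x : ℝ)) *
      ((g (‖x‖ ^ 2) * Real.exp (-(δ * ‖x‖ ^ 2)) : ℝ) : ℂ)‖ ≤
    Real.exp (-‖ξ‖) * ∫ x : V, g (‖x‖ ^ 2 - 1) * Real.exp (-(δ * (‖x‖ ^ 2 - 1)))

lemma neg_one_le_sq (r : ℝ) : -1 ≤ r ^ 2 := by nlinarith [sq_nonneg r]

lemma neg_one_le_sq_sub_one (r : ℝ) : -1 ≤ r ^ 2 - 1 := by nlinarith [sq_nonneg r]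

lemma integrable_exp_neg_mul_sq_norm_sub_one {δ : ℝ} (hδ : 0 < δ) :
    Integrable fun x : V => Real.exp (-(δ * (‖x‖ ^ 2 - 1))) := by
  refine ((integrable_exp_neg_mul_sq_norm (V := V) hδ).const_mul (Real.exp δ)).congr
    (Eventually.of_forall fun x => ?_)
  simp only [← Real.exp_add]
  ring_nf

namespace HasGaussianDecay

variable {g h : ℝ → ℝ}

lemma integrable_right (hg : HasGaussianDecay V g) {δ : ℝ} (hδ : 0 < δ) :
    Integrable fun x : V => g (‖x‖ ^ 2 - 1) * Real.exp (-(δ * (‖x‖ ^ 2 - 1))) := by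
  obtain ⟨B, hB⟩ := hg.bdd
  refine (integrable_exp_neg_mul_sq_norm_sub_one hδ).bdd_mul (c := B)
    (hg.measurable.comp (by fun_prop)).aestronglyMeasurable (Eventually.of_forall fun x => ?_)
  rw [Real.norm_of_nonneg (hg.nonneg _ (neg_one_le_sq_sub_one _))]
  exact hB _ (neg_one_le_sq_sub_one _)

lemma integrable_left (hg : HasGaussianDecay V g) {δ : ℝ} (hδ : 0 < δ) (ξ : V) :
    Integrable fun x : V => Complex.exp (-Complex.I * (inner ℝ ξ x : ℝ)) *
      ((g (‖x‖ ^ 2) * Real.exp (-(δ * ‖x‖ ^ 2)) : ℝ) : ℂ) := by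
  obtain ⟨B, hB⟩ := hg.bdd
  refine Integrable.bdd_mul (c := 1) (Integrable.ofReal ?_)
    (Continuous.aestronglyMeasurable (by fun_prop))
    (Eventually.of_forall fun x => (norm_cexp_neg_I_mul _).le)
  refine (integrable_exp_neg_mul_sq_norm hδ).bdd_mul (c := B)
    (hg.measurable.comp (by fun_prop)).aestronglyMeasurable (Eventually.of_forall fun x => ?_)
  rw [Real.norm_of_nonneg (hg.nonneg _ (neg_one_le_sq _))]
  exact hB _ (neg_one_le_sq _)

/-- The Fourier transform of the Gaussian carries `exp (-‖ξ‖²/(4δ))`, and `‖ξ‖²/(4δ) + δ ≥ ‖ξ‖`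
because the difference is `(‖ξ‖ - 2δ)²/(4δ)`. -/
lemma one : HasGaussianDecay V fun _ => 1 where
  measurable := measurable_const
  nonneg _ _ := zero_le_one
  bdd := ⟨1, fun _ _ => le_rfl⟩
  norm_integral_le δ hδ ξ := by
    have h1 : ∫ x : V, 1 * Real.exp (-(δ * (‖x‖ ^ 2 - 1))) =
        Real.exp δ * (Real.pi / δ) ^ ((Module.finrank ℝ V : ℝ) / 2) := by
      rw [← integral_exp_neg_mul_sq_norm hδ, ← integral_const_mul]
      congr 1 with x
      rw [← Real.exp_add]
      ring_nf
    rw [h1]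
    simp_rw [one_mul]
    rw [integral_cexp_inner_mul_exp_neg_mul_sq_norm hδ, Complex.norm_real,
      Real.norm_of_nonneg (by positivity), mul_comm, ← mul_assoc, ← Real.exp_add]
    gcongr
    rw [neg_le_iff_add_nonneg, ← sub_nonneg]
    have : ‖ξ‖ ^ 2 / (4 * δ) + (-‖ξ‖ + δ) - 0 = (‖ξ‖ - 2 * δ) ^ 2 / (4 * δ) := by
      field_simp
      ring
    rw [add_comm, this]
    positivity

lemma const_mul (hg : HasGaussianDecay V g) {c : ℝ} (hc : 0 ≤ c) :
    HasGaussianDecay V fun w => c * g w where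
  measurable := hg.measurable.const_mul c
  nonneg w hw := mul_nonneg hc (hg.nonneg w hw)
  bdd := by
    obtain ⟨B, hB⟩ := hg.bdd
    exact ⟨c * B, fun w hw => mul_le_mul_of_nonneg_left (hB w hw) hc⟩
  norm_integral_le δ hδ ξ := by
    have h1 : ∀ x : V, Complex.exp (-Complex.I * (inner ℝ ξ x : ℝ)) *
        ((c * g (‖x‖ ^ 2) * Real.exp (-(δ * ‖x‖ ^ 2)) : ℝ) : ℂ) = (c : ℂ) *
        (Complex.exp (-Complex.I * (inner ℝ ξ x : ℝ)) *
          ((g (‖x‖ ^ 2) * Real.exp (-(δ * ‖x‖ ^ 2)) : ℝ) : ℂ)) := fun x => by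
      push_cast
      ring
    simp_rw [h1, mul_assoc]
    rw [integral_const_mul, integral_const_mul, norm_mul, Complex.norm_real,
      Real.norm_of_nonneg hc, mul_left_comm]
    have := mul_le_mul_of_nonneg_left (hg.norm_integral_le δ hδ ξ) hc
    simpa only [mul_assoc] using this

lemma add (hg : HasGaussianDecay V g) (hh : HasGaussianDecay V h) :
    HasGaussianDecay V fun w => g w + h w where
  measurable := hg.measurable.add hh.measurable
  nonneg w hw := add_nonneg (hg.nonneg w hw) (hh.nonneg w hw)
  bdd := by
    obtain ⟨B, hB⟩ := hg.bdd
    obtain ⟨B', hB'⟩ := hh.bdd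
    exact ⟨B + B', fun w hw => add_le_add (hB w hw) (hB' w hw)⟩
  norm_integral_le δ hδ ξ := by
    simp_rw [add_mul]
    push_cast
    simp_rw [mul_add]
    have hl := integral_add (hg.integrable_left hδ ξ) (hh.integrable_left hδ ξ)
    push_cast at hl
    rw [hl, integral_add (hg.integrable_right hδ) (hh.integrable_right hδ), mul_add]
    have h1 := hg.norm_integral_le δ hδ ξ
    have h2 := hh.norm_integral_le δ hδ ξ
    push_cast at h1 h2
    exact (norm_add_le _ _).trans (add_le_add h1 h2)

lemma of_tendsto {f : ℕ → ℝ → ℝ} (hf : ∀ n, HasGaussianDecay V (f n)) (hg : Measurable g) {B : ℝ}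
    (hB : ∀ n w, -1 ≤ w → f n w ≤ B)
    (hlim : ∀ w, -1 ≤ w → Tendsto (fun n => f n w) atTop (𝓝 (g w))) : HasGaussianDecay V g where
  measurable := hg
  nonneg w hw := ge_of_tendsto' (hlim w hw) fun n => (hf n).nonneg w hw
  bdd := ⟨B, fun w hw => le_of_tendsto' (hlim w hw) fun n => hB n w hw⟩
  norm_integral_le δ hδ ξ := by
    have hl : Tendsto (fun n => ∫ x : V, Complex.exp (-Complex.I * (inner ℝ ξ x : ℝ)) *
        ((f n (‖x‖ ^ 2) * Real.exp (-(δ * ‖x‖ ^ 2)) : ℝ) : ℂ)) atTop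
        (𝓝 (∫ x : V, Complex.exp (-Complex.I * (inner ℝ ξ x : ℝ)) *
          ((g (‖x‖ ^ 2) * Real.exp (-(δ * ‖x‖ ^ 2)) : ℝ) : ℂ))) := by
      refine tendsto_integral_of_dominated_convergence
        (fun x => B * Real.exp (-(δ * ‖x‖ ^ 2)))
        (fun n => ((hf n).integrable_left hδ ξ).aestronglyMeasurable)
        ((integrable_exp_neg_mul_sq_norm hδ).const_mul B)
        (fun n => Eventually.of_forall fun x => ?_) (Eventually.of_forall fun x => ?_)
      · have h0 := (hf n).nonneg _ (neg_one_le_sq ‖x‖)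
        rw [norm_mul, norm_cexp_neg_I_mul, one_mul, Complex.norm_real,
          Real.norm_of_nonneg (by positivity)]
        gcongr
        exact hB n _ (neg_one_le_sq _)
      · exact (Tendsto.ofReal ((hlim _ (neg_one_le_sq _)).mul_const _)).const_mul _
    have hr : Tendsto (fun n => ∫ x : V, f n (‖x‖ ^ 2 - 1) * Real.exp (-(δ * (‖x‖ ^ 2 - 1)))) atTop
        (𝓝 (∫ x : V, g (‖x‖ ^ 2 - 1) * Real.exp (-(δ * (‖x‖ ^ 2 - 1))))) := by
      refine tendsto_integral_of_dominated_convergence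
        (fun x => B * Real.exp (-(δ * (‖x‖ ^ 2 - 1))))
        (fun n => ((hf n).integrable_right hδ).aestronglyMeasurable)
        ((integrable_exp_neg_mul_sq_norm_sub_one hδ).const_mul B)
        (fun n => Eventually.of_forall fun x => ?_) (Eventually.of_forall fun x => ?_)
      · have h0 := (hf n).nonneg _ (neg_one_le_sq_sub_one ‖x‖)
        rw [Real.norm_of_nonneg (by positivity)]
        gcongr
        exact hB n _ (neg_one_le_sq_sub_one _)
      · exact (hlim _ (neg_one_le_sq_sub_one _)).mul_const _
    exact le_of_tendsto_of_tendsto' hl.norm (hr.const_mul _)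
      fun n => (hf n).norm_integral_le δ hδ ξ

/-- Apart from measurability, only values on `[-1, ∞)` matter, so a constant sequence in
`of_tendsto` suffices. -/
lemma congr (hg : HasGaussianDecay V g) (hh : Measurable h) (hgh : ∀ w, -1 ≤ w → g w = h w) :
    HasGaussianDecay V h := by
  obtain ⟨B, hB⟩ := hg.bdd
  exact of_tendsto (fun _ : ℕ => hg) hh (fun _ => hB) fun w hw => by
    rw [hgh w hw]
    exact tendsto_const_nhds

/-- A factor `exp (-s w)` only changes `δ` into `δ + s`, and the bound is assumed for every `δ > 0`;
it is then integrated against the nonnegative weight `φ`. The weight `exp s` in the hypothesis is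
the value of `exp (-s w)` at the worst point `w = -1`. -/
lemma mul_laplace (hg : HasGaussianDecay V g) {φ : ℝ → ℝ} (hφ : Measurable φ)
    (hφ0 : ∀ s, 0 < s → 0 ≤ φ s) (hφi : IntegrableOn (fun s => φ s * Real.exp s) (Ioi 0)) :
    HasGaussianDecay V fun w => g w * ∫ s in Ioi (0 : ℝ), φ s * Real.exp (-(s * w)) := by
  obtain ⟨B, hB⟩ := hg.bdd
  have hpos : ∀ᵐ q : V × ℝ ∂(volume.prod (volume.restrict (Ioi 0))), q.2 ∈ Ioi (0 : ℝ) :=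
    Measure.quasiMeasurePreserving_snd.ae (ae_restrict_mem measurableSet_Ioi)
  have hφi' : IntegrableOn φ (Ioi 0) := by
    refine hφi.mono' hφ.aestronglyMeasurable ?_
    filter_upwards [ae_restrict_mem measurableSet_Ioi] with s hs
    rw [Real.norm_of_nonneg (hφ0 s hs)]
    exact le_mul_of_one_le_right (hφ0 s hs) (Real.one_le_exp (le_of_lt hs))
  have hgn := hg.nonneg
  have hgm := hg.measurable
  refine ⟨hgm.mul ?_, fun w hw => mul_nonneg (hgn w hw)
    (setIntegral_nonneg measurableSet_Ioi fun s hs => mul_nonneg (hφ0 s hs) (Real.exp_pos _).le),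
    ⟨B * ∫ s in Ioi (0 : ℝ), φ s * Real.exp s, fun w hw => ?_⟩, fun δ hδ ξ => ?_⟩
  · have : StronglyMeasurable (Function.uncurry fun (w s : ℝ) => φ s * Real.exp (-(s * w))) := by
      apply Measurable.stronglyMeasurable
      unfold Function.uncurry
      fun_prop
    exact this.integral_prod_right.measurable
  · have hB0 : 0 ≤ B := (hgn w hw).trans (hB w hw)
    refine mul_le_mul (hB w hw) ?_ (setIntegral_nonneg measurableSet_Ioi fun s hs =>
      mul_nonneg (hφ0 s hs) (Real.exp_pos _).le) hB0
    refine integral_mono_of_nonneg ?_ hφi ?_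
    · filter_upwards [ae_restrict_mem measurableSet_Ioi] with s hs
      exact mul_nonneg (hφ0 s hs) (Real.exp_pos _).le
    · filter_upwards [ae_restrict_mem measurableSet_Ioi] with s hs
      have hs' : (0 : ℝ) < s := hs
      have h0 := hφ0 s hs
      gcongr
      nlinarith
  · have hKi : Integrable (fun q : V × ℝ => (φ q.2 : ℂ) *
        (Complex.exp (-Complex.I * (inner ℝ ξ q.1 : ℝ)) *
          ((g (‖q.1‖ ^ 2) * Real.exp (-((δ + q.2) * ‖q.1‖ ^ 2)) : ℝ) : ℂ)))
        (volume.prod (volume.restrict (Ioi 0))) := by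
      refine (((integrable_exp_neg_mul_sq_norm (V := V) hδ).const_mul B).mul_prod hφi').mono'
        (Measurable.aestronglyMeasurable (by fun_prop)) ?_
      filter_upwards [hpos] with q hq
      have hq' : 0 < q.2 := hq
      have h0 := hgn _ (neg_one_le_sq ‖q.1‖)
      have h1 := hB _ (neg_one_le_sq ‖q.1‖)
      have h2 := hφ0 _ hq
      rw [norm_mul, norm_mul, norm_cexp_neg_I_mul, one_mul, Complex.norm_real, Complex.norm_real,
        Real.norm_of_nonneg h2, Real.norm_of_nonneg (by positivity), mul_comm]
      gcongr <;> linarith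
    have hRi : Integrable (fun q : V × ℝ => φ q.2 * (g (‖q.1‖ ^ 2 - 1) *
        Real.exp (-((δ + q.2) * (‖q.1‖ ^ 2 - 1))))) (volume.prod (volume.restrict (Ioi 0))) := by
      refine (((integrable_exp_neg_mul_sq_norm_sub_one (V := V) hδ).const_mul B).mul_prod hφi).mono'
        (Measurable.aestronglyMeasurable (by fun_prop)) ?_
      filter_upwards [hpos] with q hq
      have hq' : 0 < q.2 := hq
      have h0 := hgn _ (neg_one_le_sq_sub_one ‖q.1‖)
      have h1 := hB _ (neg_one_le_sq_sub_one ‖q.1‖)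
      have h2 := hφ0 _ hq
      have hB0 : 0 ≤ B := h0.trans h1
      have h3 : Real.exp (-((δ + q.2) * (‖q.1‖ ^ 2 - 1))) ≤
          Real.exp (-(δ * (‖q.1‖ ^ 2 - 1))) * Real.exp q.2 := by
        rw [← Real.exp_add]
        gcongr
        nlinarith [sq_nonneg ‖q.1‖]
      rw [Real.norm_of_nonneg (by positivity)]
      calc _ ≤ φ q.2 * (B * (Real.exp (-(δ * (‖q.1‖ ^ 2 - 1))) * Real.exp q.2)) := by gcongr
        _ = _ := by ring
    have hleft : ∫ x : V, Complex.exp (-Complex.I * (inner ℝ ξ x : ℝ)) *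
        ((g (‖x‖ ^ 2) * (∫ s in Ioi (0 : ℝ), φ s * Real.exp (-(s * ‖x‖ ^ 2))) *
          Real.exp (-(δ * ‖x‖ ^ 2)) : ℝ) : ℂ) =
        ∫ s in Ioi (0 : ℝ), (φ s : ℂ) * ∫ x : V, Complex.exp (-Complex.I * (inner ℝ ξ x : ℝ)) *
          ((g (‖x‖ ^ 2) * Real.exp (-((δ + s) * ‖x‖ ^ 2)) : ℝ) : ℂ) := by
      simp_rw [← integral_const_mul]
      rw [← integral_integral_swap (f := fun (x : V) (s : ℝ) => (φ s : ℂ) *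
        (Complex.exp (-Complex.I * (inner ℝ ξ x : ℝ)) *
          ((g (‖x‖ ^ 2) * Real.exp (-((δ + s) * ‖x‖ ^ 2)) : ℝ) : ℂ))) hKi]
      congr 1 with x
      rw [← integral_mul_const, ← integral_complex_ofReal, ← integral_const_mul]
      congr 1 with s
      rw [show -((δ + s) * ‖x‖ ^ 2) = -(δ * ‖x‖ ^ 2) + -(s * ‖x‖ ^ 2) by ring, Real.exp_add]
      push_cast
      ring
    have hright : ∫ x : V, g (‖x‖ ^ 2 - 1) * (∫ s in Ioi (0 : ℝ),
        φ s * Real.exp (-(s * (‖x‖ ^ 2 - 1)))) * Real.exp (-(δ * (‖x‖ ^ 2 - 1))) =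
        ∫ s in Ioi (0 : ℝ), φ s * ∫ x : V, g (‖x‖ ^ 2 - 1) *
          Real.exp (-((δ + s) * (‖x‖ ^ 2 - 1))) := by
      simp_rw [← integral_const_mul]
      rw [← integral_integral_swap (f := fun (x : V) (s : ℝ) => φ s *
        (g (‖x‖ ^ 2 - 1) * Real.exp (-((δ + s) * (‖x‖ ^ 2 - 1))))) hRi]
      congr 1 with x
      rw [← integral_mul_const]
      congr 1 with s
      rw [show -((δ + s) * (‖x‖ ^ 2 - 1)) = -(δ * (‖x‖ ^ 2 - 1)) + -(s * (‖x‖ ^ 2 - 1)) by ring,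
        Real.exp_add]
      ring
    rw [hleft, hright, ← integral_const_mul]
    have hint := hRi.integral_prod_right
    simp only [integral_const_mul] at hint
    refine norm_integral_le_of_norm_le (hint.const_mul _) ?_
    filter_upwards [ae_restrict_mem measurableSet_Ioi] with s hs
    have hs' : (0 : ℝ) < s := hs
    rw [norm_mul, Complex.norm_real, Real.norm_of_nonneg (hφ0 s hs), mul_left_comm]
    exact mul_le_mul_of_nonneg_left (hg.norm_integral_le _ (by positivity) ξ) (hφ0 s hs)

/-- The power is the Laplace transform of `s^(α-1) e^(-bs) / Γ(α)`, and `b > 1` makes this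
integrable against `exp s`. -/
lemma mul_rpow_neg (hg : HasGaussianDecay V g) {α b : ℝ} (hα : 0 < α) (hb : 1 < b) :
    HasGaussianDecay V fun w => g w * (w + b) ^ (-α) := by
  have hΓ := Real.Gamma_pos_of_pos hα
  have hint : IntegrableOn (fun s : ℝ => (Real.Gamma α)⁻¹ * s ^ (α - 1) * Real.exp (-(b * s)) *
      Real.exp s) (Ioi 0) := by
    have := (integrableOn_rpow_mul_exp_neg_mul_rpow (s := α - 1) (p := 1) (b := b - 1)
      (by linarith) one_pos (by linarith)).const_mul (Real.Gamma α)⁻¹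
    refine IntegrableOn.congr_fun this (fun s _ => ?_) measurableSet_Ioi
    rw [Real.rpow_one, mul_assoc, mul_assoc, ← Real.exp_add]
    ring_nf
  refine (hg.mul_laplace (by fun_prop) (fun s hs => by positivity) hint).congr
    (hg.measurable.mul (by fun_prop)) fun w hw => ?_
  have hwb : 0 < w + b := by linarith
  have h1 : ∀ s : ℝ, (Real.Gamma α)⁻¹ * s ^ (α - 1) * Real.exp (-(b * s)) * Real.exp (-(s * w)) =
      (Real.Gamma α)⁻¹ * (s ^ (α - 1) * Real.exp (-((w + b) * s))) := by
    intro s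
    rw [mul_assoc _ (Real.exp _), ← Real.exp_add, mul_assoc]
    ring_nf
  simp_rw [h1]
  rw [integral_const_mul, Real.integral_rpow_mul_exp_neg_mul_Ioi hα hwb, Real.rpow_neg hwb.le,
    one_div, Real.inv_rpow hwb.le]
  field_simp

lemma mul_one_add_div (hg : HasGaussianDecay V g) {κ b : ℝ} (hκ : 0 ≤ κ) (hb : 1 < b) :
    HasGaussianDecay V fun w => g w * (1 + κ / (w + b)) := by
  refine (hg.add ((hg.mul_rpow_neg one_pos hb).const_mul hκ)).congr
    (hg.measurable.mul (by fun_prop)) fun w _ => ?_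
  rw [Real.rpow_neg_one]
  ring

lemma mul_one_add_div_pow (hg : HasGaussianDecay V g) {κ b : ℝ} (hκ : 0 ≤ κ) (hb : 1 < b) (n : ℕ) :
    HasGaussianDecay V fun w => g w * (1 + κ / (w + b)) ^ n := by
  induction n with
  | zero => simpa using hg
  | succ n ih => simpa only [pow_succ, mul_assoc] using ih.mul_one_add_div hκ hb

/-- The exponential is the limit of `(1 + (κ/n)/(w+b))^n`, bounded on `w ≥ -1` by `exp (κ/(b-1))`.
-/
lemma mul_exp_div (hg : HasGaussianDecay V g) {κ b : ℝ} (hκ : 0 ≤ κ) (hb : 1 < b) :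
    HasGaussianDecay V fun w => g w * Real.exp (κ / (w + b)) := by
  obtain ⟨B, hB⟩ := hg.bdd
  refine of_tendsto (fun n : ℕ => hg.mul_one_add_div_pow (κ := κ / n) (by positivity) hb n)
    (hg.measurable.mul (by fun_prop)) (B := B * Real.exp (κ / (b - 1))) (fun n w hw => ?_)
    fun w hw => ?_
  · have hwb : 0 < w + b := by linarith
    have hb1 : 0 < b - 1 := by linarith
    have hg0 := hg.nonneg w hw
    have h1 : (1 + κ / n / (w + b)) ^ n ≤ Real.exp (κ / (b - 1)) := by
      calc (1 + κ / n / (w + b)) ^ n ≤ Real.exp (κ / n / (w + b)) ^ n := by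
            gcongr
            rw [add_comm]
            exact Real.add_one_le_exp _
        _ = Real.exp (n * (κ / n / (w + b))) := by rw [Real.exp_nat_mul]
        _ ≤ Real.exp (κ / (b - 1)) := by
            apply Real.exp_le_exp.2
            rcases Nat.eq_zero_or_pos n with rfl | hn
            · simp only [Nat.cast_zero, zero_mul]
              positivity
            · have hn' : (n : ℝ) ≠ 0 := by positivity
              rw [show (n : ℝ) * (κ / n / (w + b)) = κ / (w + b) by field_simp]
              gcongr
              linarith
    have := hB w hw
    have hB0 : 0 ≤ B := hg0.trans this
    gcongr
  · have := Real.tendsto_one_add_div_pow_exp (κ / (w + b))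
    refine (this.congr fun n => ?_).const_mul _
    rw [div_right_comm]

end HasGaussianDecay

end GaussianMixtures

/-! ### Finite-product approximation of the profile -/

section SinhProduct

/-- The number `(π (j + 1))²`, minus which is a zero of the even entire function
`w ↦ sinh √w / √w`. -/
noncomputable def sinhZero (j : ℕ) : ℝ := (Real.pi * (j + 1)) ^ 2

lemma nine_mul_le_sinhZero (j : ℕ) : 9 * ((j : ℝ) + 1) ^ 2 ≤ sinhZero j := by
  unfold sinhZero
  rw [mul_pow]
  gcongr
  nlinarith [Real.pi_gt_three]

lemma one_lt_sinhZero (j : ℕ) : 1 < sinhZero j := by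
  have h0 : (0 : ℝ) ≤ j := Nat.cast_nonneg j
  nlinarith [nine_mul_le_sinhZero j]

lemma sinhZero_pos (j : ℕ) : 0 < sinhZero j := one_pos.trans (one_lt_sinhZero j)

lemma sinhZero_mono : Monotone sinhZero := fun i j hij => by
  unfold sinhZero
  gcongr

/-- Euler's product for `sin πx` at the imaginary point `x = ir/π`. -/
lemma tendsto_prod_sinh {r : ℝ} (hr : 0 < r) :
    Tendsto (fun n : ℕ => ∏ j ∈ Finset.range n, (1 + r ^ 2 / sinhZero j)) atTop
      (𝓝 (Real.sinh r / r)) := by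
  have hπ : (Real.pi : ℂ) ≠ 0 := by exact_mod_cast Real.pi_ne_zero
  have hrc : (r : ℂ) ≠ 0 := by exact_mod_cast hr.ne'
  have h := Complex.tendsto_euler_sin_prod (r * Complex.I / Real.pi)
  have hterm : ∀ j : ℕ, (1 : ℂ) - (r * Complex.I / Real.pi) ^ 2 / ((j : ℂ) + 1) ^ 2 =
      ((1 + r ^ 2 / sinhZero j : ℝ) : ℂ) := fun j => by
    have hj : (j : ℂ) + 1 ≠ 0 := by exact_mod_cast Nat.succ_ne_zero j
    unfold sinhZero
    push_cast
    rw [div_pow, mul_pow, Complex.I_sq]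
    field_simp
    ring
  simp_rw [hterm] at h
  rw [mul_div_cancel₀ _ hπ, Complex.sin_mul_I] at h
  have h2 := h.const_mul ((r * Complex.I : ℂ)⁻¹)
  have hrI : (r * Complex.I : ℂ) ≠ 0 := mul_ne_zero hrc Complex.I_ne_zero
  simp_rw [inv_mul_cancel_left₀ hrI] at h2
  have h3 : (r * Complex.I : ℂ)⁻¹ * (Complex.sinh r * Complex.I) = ((Real.sinh r / r : ℝ) : ℂ) := by
    push_cast
    field_simp
  rw [h3] at h2
  have h4 := (Complex.continuous_re.tendsto _).comp h2
  rw [Complex.ofReal_re] at h4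
  refine h4.congr fun n => ?_
  rw [Function.comp_apply, ← Complex.ofReal_prod, Complex.ofReal_re]

/-- The partial fractions of `π cot πx - 1/x` at `x = ir/π`, multiplied by `x`. -/
lemma tendsto_sum_div_tanh {r : ℝ} (hr : 0 < r) :
    Tendsto (fun n : ℕ => ∑ j ∈ Finset.range n, 2 * r ^ 2 / (r ^ 2 + sinhZero j)) atTop
      (𝓝 (r / Real.tanh r - 1)) := by
  have hπ : (Real.pi : ℂ) ≠ 0 := by exact_mod_cast Real.pi_ne_zero
  have hrc : (r : ℂ) ≠ 0 := by exact_mod_cast hr.ne'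
  set x : ℂ := r * Complex.I / Real.pi with hx
  have hx0 : x ≠ 0 := div_ne_zero (mul_ne_zero hrc Complex.I_ne_zero) hπ
  have hxC : x ∈ Complex.integerComplement := by
    rintro ⟨n, hn⟩
    have := congrArg Complex.im hn
    rw [hx, show (r : ℂ) * Complex.I / Real.pi = ((r / Real.pi : ℝ) : ℂ) * Complex.I by
      push_cast; ring, Complex.im_ofReal_mul, Complex.I_im] at this
    have hpos : 0 < r / Real.pi := by positivity
    rw [Complex.intCast_im, mul_one] at this
    exact hpos.ne this
  have h := (tendsto_logDeriv_euler_cot_sub hxC).const_mul x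
  have hterm : ∀ j : ℕ, x * cotTerm x j = ((2 * r ^ 2 / (r ^ 2 + sinhZero j) : ℝ) : ℂ) := by
    intro j
    have hden : ((r ^ 2 + sinhZero j : ℝ) : ℂ) ≠ 0 := by
      have := sinhZero_pos j
      exact_mod_cast (by positivity : r ^ 2 + sinhZero j ≠ 0)
    rw [cotTerm_identity hxC]
    have hmul : (x + (j + 1)) * (x - (j + 1)) =
        -((r ^ 2 + sinhZero j : ℝ) : ℂ) / (Real.pi : ℂ) ^ 2 := by
      unfold sinhZero
      rw [hx]
      push_cast
      field_simp
      ring_nf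
      rw [Complex.I_sq]
      ring
    have hx2 : x ^ 2 = -(r : ℂ) ^ 2 / (Real.pi : ℂ) ^ 2 := by
      rw [hx, div_pow, mul_pow, Complex.I_sq]
      ring
    rw [hmul, show x * (2 * x * (1 / (-((r ^ 2 + sinhZero j : ℝ) : ℂ) / (Real.pi : ℂ) ^ 2))) =
      2 * x ^ 2 * (1 / (-((r ^ 2 + sinhZero j : ℝ) : ℂ) / (Real.pi : ℂ) ^ 2)) by ring, hx2,
      Complex.ofReal_div]
    push_cast at hden ⊢
    field_simp
  have hsinh : (Complex.sinh r) ≠ 0 := by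
    exact_mod_cast (Real.sinh_pos_iff.2 hr).ne'
  have hval : x * (Real.pi * Complex.cot (Real.pi * x) - 1 / x) =
      ((r / Real.tanh r - 1 : ℝ) : ℂ) := by
    have hπx : Real.pi * x = r * Complex.I := by
      rw [hx, mul_div_cancel₀ _ hπ]
    rw [mul_sub, mul_one_div_cancel hx0, mul_left_comm, ← mul_assoc, hπx, Complex.cot,
      Complex.sin_mul_I, Complex.cos_mul_I, Real.tanh_eq_sinh_div_cosh]
    push_cast
    field_simp
  rw [hval] at h
  have h4 := (Complex.continuous_re.tendsto _).comp h
  rw [Complex.ofReal_re] at h4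
  refine h4.congr fun n => ?_
  rw [Function.comp_apply, Finset.mul_sum]
  simp_rw [hterm]
  rw [← Complex.ofReal_sum, Complex.ofReal_re]

/-- Comparison with the telescoping product of `1 - 1/(j+2)²`, which equals `(n+2)/(2(n+1))`. -/
lemma half_le_prod_one_sub (n : ℕ) :
    1 / 2 ≤ ∏ j ∈ Finset.range n, (1 - 1 / sinhZero j) := by
  have key : ∀ n : ℕ, ((n : ℝ) + 2) / (2 * (n + 1)) ≤
      ∏ j ∈ Finset.range n, (1 - 1 / sinhZero j) := by
    intro n
    induction n with
    | zero => simp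
    | succ n ih =>
      rw [Finset.prod_range_succ]
      have h0 : (0 : ℝ) ≤ n := Nat.cast_nonneg n
      have h1 : 1 - 1 / ((n : ℝ) + 2) ^ 2 ≤ 1 - 1 / sinhZero n := by
        have h3 : ((n : ℝ) + 2) ^ 2 ≤ sinhZero n := by nlinarith [nine_mul_le_sinhZero n]
        exact sub_le_sub_left (one_div_le_one_div_of_le (by positivity) h3) _
      have h2 : (0 : ℝ) ≤ 1 - 1 / ((n : ℝ) + 2) ^ 2 := by
        rw [sub_nonneg, div_le_one (by positivity)]
        nlinarith
      calc (((n + 1 : ℕ) : ℝ) + 2) / (2 * ((n + 1 : ℕ) + 1))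
          = ((n : ℝ) + 2) / (2 * (n + 1)) * (1 - 1 / ((n : ℝ) + 2) ^ 2) := by
            push_cast
            field_simp
            ring
        _ ≤ _ := mul_le_mul ih h1 h2 (le_trans (by positivity) ih)
  refine le_trans ?_ (key n)
  rw [div_le_div_iff₀ two_pos (by positivity)]
  linarith

/-- Comparison with the telescoping series of `1/(2(j+1)(j+2))`. -/
lemma sum_two_div_sinhZero_sub_one_le (n : ℕ) :
    ∑ j ∈ Finset.range n, 2 / (sinhZero j - 1) ≤ 1 := by
  have key : ∀ n : ℕ, ∑ j ∈ Finset.range n, 2 / (sinhZero j - 1) ≤ 1 / 2 * (1 - 1 / (n + 1)) := by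
    intro n
    induction n with
    | zero => simp
    | succ n ih =>
      rw [Finset.sum_range_succ]
      have h0 : (0 : ℝ) ≤ n := Nat.cast_nonneg n
      have h1 : 2 / (sinhZero n - 1) ≤ 2 / (4 * ((n : ℝ) + 1) * (n + 2)) := by
        gcongr
        nlinarith [nine_mul_le_sinhZero n]
      calc _ ≤ 1 / 2 * (1 - 1 / ((n : ℝ) + 1)) + 2 / (4 * ((n : ℝ) + 1) * (n + 2)) := by gcongr
        _ = _ := by
          push_cast
          field_simp
          ring
  refine (key n).trans ?_
  have : (0 : ℝ) ≤ 1 / (n + 1) := by positivity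
  linarith

lemma one_add_div_sinhZero_pos (j : ℕ) {w : ℝ} (hw : -1 ≤ w) : 0 < 1 + w / sinhZero j := by
  have h1 := one_lt_sinhZero j
  have : 0 < sinhZero j + w := by linarith
  have h2 : 1 + w / sinhZero j = (sinhZero j + w) / sinhZero j := by
    field_simp [(sinhZero_pos j).ne']
  rw [h2]
  exact div_pos this (sinhZero_pos j)

/-- With `b = sinhZero j`, `(1 - 1/b)(1 + (w+1)/b) ≤ 1 + w/b` moves the base point to `w = -1`. The
first factors multiply to at least `1/2`; of the second, all at least `1`, the first `m` are kept,
giving polynomial growth of degree `m` uniformly in `n`. -/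
lemma le_prod_one_add_div_sinhZero {m n : ℕ} (hmn : m ≤ n) {w : ℝ} (hw : -1 ≤ w) :
    1 / 2 * ((1 + (w + 1)) / sinhZero m) ^ m ≤
      ∏ j ∈ Finset.range n, (1 + w / sinhZero j) := by
  have hw1 : 0 ≤ w + 1 := by linarith
  calc 1 / 2 * ((1 + (w + 1)) / sinhZero m) ^ m
      ≤ (∏ j ∈ Finset.range n, (1 - 1 / sinhZero j)) *
          ∏ j ∈ Finset.range n, (1 + (w + 1) / sinhZero j) := by
        have h1 : ((1 + (w + 1)) / sinhZero m) ^ m ≤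
            ∏ j ∈ Finset.range m, (1 + (w + 1) / sinhZero j) := by
          rw [← Finset.card_range m, ← Finset.prod_const, Finset.card_range]
          refine Finset.prod_le_prod (fun j _ => ?_) fun j hj => ?_
          · have := sinhZero_pos m
            positivity
          · have hj' := sinhZero_mono (Finset.mem_range.1 hj).le
            have hp := sinhZero_pos j
            have hm := one_lt_sinhZero m
            rw [add_div]
            gcongr
            rw [div_le_one (by linarith)]
            exact hm.le
        have hmono : Monotone fun n : ℕ => ∏ j ∈ Finset.range n, (1 + (w + 1) / sinhZero j) := by
          refine monotone_nat_of_le_succ fun n => ?_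
          have hterm : ∀ j, 0 ≤ (w + 1) / sinhZero j := fun j =>
            div_nonneg hw1 (sinhZero_pos j).le
          rw [Finset.prod_range_succ]
          exact le_mul_of_one_le_right (Finset.prod_nonneg fun j _ => by linarith [hterm j])
            (by linarith [hterm n])
        have h2 := hmono hmn
        have h3 : 0 ≤ ((1 + (w + 1)) / sinhZero m) ^ m := by
          have := sinhZero_pos m
          positivity
        exact mul_le_mul (half_le_prod_one_sub n) (h1.trans h2) h3
          (le_trans (by norm_num) (half_le_prod_one_sub n))
    _ = ∏ j ∈ Finset.range n, ((1 - 1 / sinhZero j) * (1 + (w + 1) / sinhZero j)) := by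
        rw [Finset.prod_mul_distrib]
    _ ≤ _ := by
        refine Finset.prod_le_prod (fun j _ => ?_) fun j _ => ?_
        · have := sinhZero_pos j
          have h1 : 1 / sinhZero j ≤ 1 := by
            rw [div_le_one this]
            exact (one_lt_sinhZero j).le
          have : 0 ≤ (w + 1) / sinhZero j := by positivity
          exact mul_nonneg (by linarith) (by linarith)
        · have := sinhZero_pos j
          have h1 : (1 - 1 / sinhZero j) * (1 + (w + 1) / sinhZero j) =
              1 + w / sinhZero j - (w + 1) / sinhZero j ^ 2 := by
            field_simp
            ring
          have h2 : 0 ≤ (w + 1) / sinhZero j ^ 2 := by positivity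
          linarith

/-- The finite-product approximation of `mehlerProfile α A r` as a function of `w = r²`. -/
noncomputable def mehlerApprox (α A : ℝ) (n : ℕ) (w : ℝ) : ℝ :=
  Real.exp (-A) * ((∏ j ∈ Finset.range n, (1 + w / sinhZero j)) ^ (-α) *
    Real.exp (-A * ∑ j ∈ Finset.range n, 2 * w / (w + sinhZero j)))

lemma measurable_mehlerApprox (α A : ℝ) (n : ℕ) : Measurable (mehlerApprox α A n) := by
  unfold mehlerApprox
  fun_prop

lemma tendsto_mehlerApprox (α A : ℝ) {r : ℝ} (hr : 0 < r) :
    Tendsto (fun n => mehlerApprox α A n (r ^ 2)) atTop (𝓝 (mehlerProfile α A r)) := by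
  have hs : 0 < Real.sinh r / r := div_pos (Real.sinh_pos_iff.2 hr) hr
  have h1 := (tendsto_prod_sinh hr).rpow_const (p := -α) (Or.inl hs.ne')
  have h2 := (Real.continuous_exp.tendsto _).comp ((tendsto_sum_div_tanh hr).const_mul (-A))
  have h3 := (h1.mul h2).const_mul (Real.exp (-A))
  have h4 : Real.exp (-A) * ((Real.sinh r / r) ^ (-α) *
      Real.exp (-A * (r / Real.tanh r - 1))) = mehlerProfile α A r := by
    rw [mehlerProfile, mul_left_comm, ← Real.exp_add, Real.rpow_neg hs.le,
      ← Real.inv_rpow hs.le, inv_div]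
    ring_nf
  rw [h4] at h3
  exact h3

lemma mehlerApprox_le {α A : ℝ} (hα : 0 < α) (hA : 0 ≤ A) {m n : ℕ} (hmn : m ≤ n) {w : ℝ}
    (hw : -1 ≤ w) :
    mehlerApprox α A n w ≤
      2 ^ α * sinhZero m ^ (α * m) * (1 + (w + 1)) ^ (-(α * m)) := by
  have hw1 : 0 < 1 + (w + 1) := by linarith
  have hm := sinhZero_pos m
  have hle := le_prod_one_add_div_sinhZero hmn hw
  have hexp : Real.exp (-A) * Real.exp (-A * ∑ j ∈ Finset.range n, 2 * w / (w + sinhZero j)) ≤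
      1 := by
    rw [← Real.exp_add, Real.exp_le_one_iff]
    -- For `w < 0` the sum is negative or zero, but no less than `-1`, so the prefactor `exp (-A)`
    -- absorbs its effect uniformly in `A`.
    have : -∑ j ∈ Finset.range n, 2 * w / (w + sinhZero j) ≤ 1 := by
      rw [← Finset.sum_neg_distrib]
      refine (Finset.sum_le_sum fun j _ => ?_).trans (sum_two_div_sinhZero_sub_one_le n)
      have := one_lt_sinhZero j
      rw [← neg_div, div_le_div_iff₀ (by linarith) (by linarith)]
      nlinarith
    nlinarith
  have hpow : (∏ j ∈ Finset.range n, (1 + w / sinhZero j)) ^ (-α) ≤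
      2 ^ α * sinhZero m ^ (α * m) * (1 + (w + 1)) ^ (-(α * m)) := by
    have hpos : 0 < 1 / 2 * ((1 + (w + 1)) / sinhZero m) ^ m := by positivity
    refine (Real.rpow_le_rpow_of_nonpos hpos hle (by linarith)).trans_eq ?_
    rw [← Real.rpow_natCast, Real.mul_rpow (by norm_num) (by positivity),
      ← Real.rpow_mul (by positivity), Real.div_rpow hw1.le hm.le, one_div,
      Real.inv_rpow two_pos.le, Real.rpow_neg two_pos.le, inv_inv,
      show (m : ℝ) * -α = -(α * m) by ring, Real.rpow_neg hm.le]
    field_simp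
  calc mehlerApprox α A n w = (∏ j ∈ Finset.range n, (1 + w / sinhZero j)) ^ (-α) *
        (Real.exp (-A) * Real.exp (-A * ∑ j ∈ Finset.range n, 2 * w / (w + sinhZero j))) := by
        unfold mehlerApprox
        ring
    _ ≤ (∏ j ∈ Finset.range n, (1 + w / sinhZero j)) ^ (-α) * 1 := by
        gcongr
        exact Real.rpow_nonneg (Finset.prod_nonneg fun j _ =>
          (one_add_div_sinhZero_pos j hw).le) _
    _ ≤ _ := by rwa [mul_one]

/-- Each new index contributes a factor `(w+b)^(-α)` and, since `2w/(w+b) = 2 - 2b/(w+b)`, a factor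
`exp (2Ab/(w+b))`, up to positive constants; both preserve Gaussian decay. -/
lemma hasGaussianDecay_mehlerApprox (V : Type*) [NormedAddCommGroup V] [InnerProductSpace ℝ V]
    [FiniteDimensional ℝ V] [MeasurableSpace V] [BorelSpace V] {α A : ℝ} (hα : 0 < α) (hA : 0 ≤ A)
    (n : ℕ) : HasGaussianDecay V (mehlerApprox α A n) := by
  induction n with
  | zero =>
    refine (HasGaussianDecay.one.const_mul (Real.exp_pos (-A)).le).congr
      (measurable_mehlerApprox _ _ _) fun w _ => ?_
    simp [mehlerApprox]
  | succ n ih =>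
    have hb := one_lt_sinhZero n
    have hb0 := sinhZero_pos n
    refine (((ih.mul_rpow_neg hα hb).mul_exp_div (κ := 2 * A * sinhZero n) (by positivity)
      hb).const_mul (c := sinhZero n ^ α * Real.exp (-(2 * A))) (by positivity)).congr
      (measurable_mehlerApprox _ _ _) fun w hw => ?_
    have hwb : 0 < w + sinhZero n := by linarith
    unfold mehlerApprox
    rw [Finset.prod_range_succ, Finset.sum_range_succ, Real.mul_rpow
      (Finset.prod_nonneg fun j _ => (one_add_div_sinhZero_pos j hw).le)
      (one_add_div_sinhZero_pos n hw).le, mul_add, Real.exp_add]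
    have h1 : (1 + w / sinhZero n) ^ (-α) = sinhZero n ^ α * (w + sinhZero n) ^ (-α) := by
      rw [show 1 + w / sinhZero n = (w + sinhZero n) / sinhZero n by field_simp; ring,
        Real.div_rpow hwb.le hb0.le, Real.rpow_neg hb0.le, div_inv_eq_mul, mul_comm]
    have h2 : Real.exp (-A * (2 * w / (w + sinhZero n))) =
        Real.exp (-(2 * A)) * Real.exp (2 * A * sinhZero n / (w + sinhZero n)) := by
      rw [← Real.exp_add]
      congr 1
      field_simp
      ring
    rw [h1, h2]
    ring

end SinhProduct

/-! ### Uniform exponential decay of the Fourier transform of the profile -/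

section Decay

variable (V : Type*) [NormedAddCommGroup V] [InnerProductSpace ℝ V] [FiniteDimensional ℝ V]
  [MeasurableSpace V] [BorelSpace V]

local notation "dim" => Module.finrank ℝ V

/-- An integrable majorant of all late approximations, at `w = |x|² - 1` and at `w = |x|²`. -/
lemma exists_integrable_majorant {α : ℝ} (hα : 0 < α) :
    ∃ (m : ℕ) (M : ℝ → ℝ), Integrable (fun x : V => M (‖x‖ ^ 2)) ∧
      ∀ A, 0 ≤ A → ∀ n, m ≤ n → ∀ v, 0 ≤ v →
        mehlerApprox α A n (v - 1) ≤ M v ∧ mehlerApprox α A n v ≤ M v := by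
  -- Then `2αm > dim`, which makes `(1 + ‖x‖²)^(-αm)` integrable.
  obtain ⟨m, hm⟩ := exists_nat_gt ((dim : ℝ) / (2 * α))
  rw [div_lt_iff₀ (by positivity)] at hm
  refine ⟨m, fun v => 2 ^ α * sinhZero m ^ (α * m) * (1 + v) ^ (-(α * m)), ?_, ?_⟩
  · have := integrable_rpow_neg_one_add_norm_sq (E := V) (μ := volume) (r := 2 * (α * m))
      (by linarith)
    rw [show -(2 * (α * m)) / 2 = -(α * m) by ring] at this
    exact this.const_mul _
  · intro A hA n hmn v hv
    have hz := sinhZero_pos m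
    constructor
    · have := mehlerApprox_le hα hA hmn (w := v - 1) (by linarith)
      rwa [sub_add_cancel] at this
    · refine (mehlerApprox_le hα hA hmn (w := v) (by linarith)).trans ?_
      refine mul_le_mul_of_nonneg_left ?_ (by positivity)
      exact Real.rpow_le_rpow_of_nonpos (by linarith) (by linarith)
        (neg_nonpos.2 (by positivity))

variable [Nontrivial V]

lemma integrable_div_sinh_rpow {α : ℝ} (hα : 0 < α) :
    Integrable fun x : V => (‖x‖ / Real.sinh ‖x‖) ^ α := by
  obtain ⟨m, M, hMi, hM⟩ := exists_integrable_majorant V hα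
  refine hMi.mono' (Measurable.aestronglyMeasurable (by fun_prop)) ?_
  filter_upwards [ae_norm_pos (V := V)] with x hx
  rw [Real.norm_of_nonneg (Real.rpow_nonneg (div_sinh_nonneg hx.le) _)]
  have h1 : mehlerProfile α 0 ‖x‖ = (‖x‖ / Real.sinh ‖x‖) ^ α := by simp [mehlerProfile]
  rw [← h1]
  exact le_of_tendsto (tendsto_mehlerApprox α 0 hx)
    (eventually_atTop.2 ⟨m, fun n hn => (hM 0 le_rfl n hn _ (sq_nonneg _)).2⟩)

/-- The Fourier transform of the radial factor of the Mehler kernel decays exponentially, uniformly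
in the parameter `A`. -/
lemma exists_norm_integral_mehlerProfile_le {α : ℝ} (hα : 0 < α) :
    ∃ C, ∀ A, 0 ≤ A → ∀ ξ : V,
      ‖∫ x : V, Complex.exp (-Complex.I * (inner ℝ ξ x : ℝ)) * (mehlerProfile α A ‖x‖ : ℝ)‖ ≤
        C * Real.exp (-‖ξ‖) := by
  obtain ⟨m, M, hMi, hM⟩ := exists_integrable_majorant V hα
  refine ⟨Real.exp 1 * ∫ x : V, M (‖x‖ ^ 2), fun A hA ξ => ?_⟩
  -- The Gaussian damping is removed along with `n → ∞`; `δ n ≤ 1` bounds `exp (-δ(‖x‖² - 1))` by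
  -- `exp 1`, the constant in the witness.
  set δ : ℕ → ℝ := fun n => 1 / ((n : ℝ) + 1) with hδ_def
  have hδ0 : ∀ n, 0 < δ n := fun n => by positivity
  have hδ1 : ∀ n, δ n ≤ 1 := fun n => by
    rw [hδ_def, div_le_one (by positivity)]
    linarith [(Nat.cast_nonneg n : (0 : ℝ) ≤ n)]
  have hδ : Tendsto δ atTop (𝓝 0) := tendsto_one_div_add_atTop_nhds_zero_nat
  have hdec := fun n => hasGaussianDecay_mehlerApprox V hα hA n
  have hlim : Tendsto (fun n => ∫ x : V, Complex.exp (-Complex.I * (inner ℝ ξ x : ℝ)) *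
      ((mehlerApprox α A n (‖x‖ ^ 2) * Real.exp (-(δ n * ‖x‖ ^ 2)) : ℝ) : ℂ)) atTop
      (𝓝 (∫ x : V, Complex.exp (-Complex.I * (inner ℝ ξ x : ℝ)) *
        (mehlerProfile α A ‖x‖ : ℝ))) := by
    refine tendsto_integral_filter_of_dominated_convergence (fun x => M (‖x‖ ^ 2))
      (Eventually.of_forall fun n => ((hdec n).integrable_left (hδ0 n) ξ).aestronglyMeasurable)
      (eventually_atTop.2 ⟨m, fun n hn => Eventually.of_forall fun x => ?_⟩) hMi ?_
    · have h0 := (hdec n).nonneg _ (neg_one_le_sq ‖x‖)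
      rw [norm_mul, norm_cexp_neg_I_mul, one_mul, Complex.norm_real,
        Real.norm_of_nonneg (by positivity)]
      refine (mul_le_of_le_one_right h0 ?_).trans (hM A hA n hn _ (sq_nonneg _)).2
      rw [Real.exp_le_one_iff, neg_nonpos]
      have := hδ0 n
      positivity
    · filter_upwards [ae_norm_pos (V := V)] with x hx
      refine (Tendsto.ofReal ?_).const_mul _
      have h1 : Tendsto (fun n => Real.exp (-(δ n * ‖x‖ ^ 2))) atTop (𝓝 1) := by
        have := (Real.continuous_exp.tendsto _).comp (hδ.mul_const (‖x‖ ^ 2)).neg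
        simpa [Function.comp_def] using this
      simpa using (tendsto_mehlerApprox α A hx).mul h1
  refine le_of_tendsto hlim.norm (eventually_atTop.2 ⟨m, fun n hn => ?_⟩)
  refine ((hdec n).norm_integral_le (δ n) (hδ0 n) ξ).trans ?_
  rw [mul_comm]
  gcongr
  rw [← integral_const_mul]
  refine integral_mono ((hdec n).integrable_right (hδ0 n)) (hMi.const_mul _) fun x => ?_
  have h0 := (hdec n).nonneg _ (neg_one_le_sq_sub_one ‖x‖)
  have h1 := (hM A hA n hn _ (sq_nonneg ‖x‖)).1
  have h2 : Real.exp (-(δ n * (‖x‖ ^ 2 - 1))) ≤ Real.exp 1 := by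
    apply Real.exp_le_exp.2
    nlinarith [hδ0 n, hδ1 n, sq_nonneg ‖x‖, mul_nonneg (hδ0 n).le (sq_nonneg ‖x‖)]
  simp only
  rw [mul_comm (Real.exp 1)]
  exact mul_le_mul h1 h2 (Real.exp_pos _).le (h0.trans h1)

end Decay

/-! ### The potential for all `a ≥ 0` -/

section Potential

variable {V : Type*} [NormedAddCommGroup V] [InnerProductSpace ℝ V] [FiniteDimensional ℝ V]
  [MeasurableSpace V] [BorelSpace V]

local notation "dim" => Module.finrank ℝ V

/-- The Fourier integral of the Mehler kernel as a function of `a = |z|² / 4` and `τ = 1 / t`. -/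
noncomputable def mehlerFourier (α a : ℝ) (σ : V) (τ : ℝ) : ℂ :=
  ∫ l : V, Complex.exp (-Complex.I * ((τ * inner ℝ σ l : ℝ) : ℂ)) *
    (mehlerProfile α (τ * a) ‖l‖ : ℝ)

lemma measurable_mehlerFourier_integrand (α a : ℝ) (σ : V) :
    Measurable fun q : ℝ × V => Complex.exp (-Complex.I * ((q.1 * inner ℝ σ q.2 : ℝ) : ℂ)) *
      (mehlerProfile α (q.1 * a) ‖q.2‖ : ℝ) := by
  have h := (measurable_mehlerProfile α).comp
    (f := fun q : ℝ × V => (q.1 * a, ‖q.2‖)) (by fun_prop)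
  have : Measurable fun q : ℝ × V => mehlerProfile α (q.1 * a) ‖q.2‖ := h
  fun_prop

lemma stronglyMeasurable_mehlerFourier (α a : ℝ) (σ : V) :
    StronglyMeasurable (mehlerFourier α a σ) := by
  have h : StronglyMeasurable (Function.uncurry fun (τ : ℝ) (l : V) =>
      Complex.exp (-Complex.I * ((τ * inner ℝ σ l : ℝ) : ℂ)) *
        ((mehlerProfile α (τ * a) ‖l‖ : ℝ) : ℂ)) :=
    (measurable_mehlerFourier_integrand α a σ).stronglyMeasurable
  exact h.integral_prod_right

variable [Nontrivial V]

lemma ae_norm_mehlerFourier_integrand_le (α : ℝ) {a τ : ℝ} (ha : 0 ≤ a) (hτ : 0 ≤ τ) (σ : V) :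
    ∀ᵐ l : V, ‖Complex.exp (-Complex.I * ((τ * inner ℝ σ l : ℝ) : ℂ)) *
      ((mehlerProfile α (τ * a) ‖l‖ : ℝ) : ℂ)‖ ≤ (‖l‖ / Real.sinh ‖l‖) ^ α := by
  filter_upwards [ae_norm_pos (V := V)] with l hl
  rw [norm_mul, norm_cexp_neg_I_mul, one_mul, Complex.norm_real,
    Real.norm_of_nonneg (mehlerProfile_nonneg _ _ hl.le)]
  have hA : 0 ≤ τ * a := mul_nonneg hτ ha
  refine (mehlerProfile_le_mul_exp_neg α hA hl).trans (mul_le_of_le_one_right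
    (Real.rpow_nonneg (div_sinh_nonneg hl.le) _) ?_)
  rwa [Real.exp_le_one_iff, neg_nonpos]

lemma integrable_mehlerFourier_integrand {α a τ : ℝ} (hα : 0 < α) (ha : 0 ≤ a) (hτ : 0 ≤ τ)
    (σ : V) :
    Integrable fun l : V => Complex.exp (-Complex.I * ((τ * inner ℝ σ l : ℝ) : ℂ)) *
      ((mehlerProfile α (τ * a) ‖l‖ : ℝ) : ℂ) :=
  (integrable_div_sinh_rpow V hα).mono'
    ((measurable_mehlerFourier_integrand α a σ).comp measurable_prodMk_left).aestronglyMeasurable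
    (ae_norm_mehlerFourier_integrand_le α ha hτ σ)

/-- The uniform decay is applied at frequency `τσ` with parameter `A = τa`; uniformity in `A` makes
`C` independent of both `a` and `τ`. -/
lemma exists_norm_mehlerFourier_le {α : ℝ} (hα : 0 < α) (σ : V) :
    ∃ C, ∀ a, 0 ≤ a → ∀ τ, 0 ≤ τ → ‖mehlerFourier α a σ τ‖ ≤ C * Real.exp (-(‖σ‖ * τ)) := by
  obtain ⟨C, hC⟩ := exists_norm_integral_mehlerProfile_le V hα
  refine ⟨C, fun a ha τ hτ => ?_⟩
  have h := hC (τ * a) (mul_nonneg hτ ha) (τ • σ)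
  rw [norm_smul, Real.norm_of_nonneg hτ, mul_comm τ ‖σ‖] at h
  simpa only [inner_smul_left, mehlerFourier, RCLike.conj_to_real] using h

/-- The potential of the generalized Mehler kernel, up to a constant factor, in terms of
`a = |z|² / 4` and `σ`. -/
lemma integral_rpow_mul_mehlerFourier {α a : ℝ} (hα : 0 < α) (ha : 0 ≤ a) {σ : V}
    (h : a ≠ 0 ∨ σ ≠ 0) :
    IntegrableOn (fun τ : ℝ => ((τ ^ (α + dim - 1 - 1) : ℝ) : ℂ) * mehlerFourier α a σ τ)
      (Ioi 0) ∧
    ∫ τ in Ioi (0 : ℝ), ((τ ^ (α + dim - 1 - 1) : ℝ) : ℂ) * mehlerFourier α a σ τ =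
    ((hyperboloidConst α dim (a ^ 2 + ‖σ‖ ^ 2) * Real.Gamma (α / 2) / √Real.pi : ℝ) : ℂ) := by
  have hd : (1 : ℝ) ≤ (dim : ℝ) := by exact_mod_cast Module.finrank_pos (R := ℝ) (M := V)
  have hp : 0 < α + dim - 1 := by linarith
  have hF := integrable_div_sinh_rpow V hα
  rcases ha.eq_or_lt with rfl | ha
  · have hσ : 0 < ‖σ‖ := norm_pos_iff.2 (by simpa using h)
    obtain ⟨C, hC⟩ := exists_norm_mehlerFourier_le hα σ
    have hmeas : ∀ a, AEStronglyMeasurable (fun τ : ℝ => ((τ ^ (α + dim - 1 - 1) : ℝ) : ℂ) *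
        mehlerFourier α a σ τ) (volume.restrict (Ioi 0)) := fun a => by
      have h1 : Measurable fun τ : ℝ => ((τ ^ (α + dim - 1 - 1) : ℝ) : ℂ) := by fun_prop
      exact (h1.stronglyMeasurable.mul
        (stronglyMeasurable_mehlerFourier α a σ)).aestronglyMeasurable
    have hbi : IntegrableOn (fun τ : ℝ => C * (τ ^ (α + dim - 1 - 1) * Real.exp (-(‖σ‖ * τ))))
        (Ioi 0) := by
      have := integrableOn_rpow_mul_exp_neg_mul_rpow (s := α + dim - 1 - 1) (p := 1) (b := ‖σ‖)
        (by linarith) one_pos hσ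
      simp only [Real.rpow_one, neg_mul] at this
      exact this.const_mul C
    have hb : ∀ a, 0 ≤ a → ∀ᵐ τ ∂(volume.restrict (Ioi (0 : ℝ))),
        ‖((τ ^ (α + dim - 1 - 1) : ℝ) : ℂ) * mehlerFourier α a σ τ‖ ≤
        C * (τ ^ (α + dim - 1 - 1) * Real.exp (-(‖σ‖ * τ))) := fun a ha => by
      filter_upwards [ae_restrict_mem measurableSet_Ioi] with τ hτ
      have hτ' : (0 : ℝ) < τ := hτ
      rw [norm_mul, Complex.norm_real, Real.norm_of_nonneg (by positivity), mul_left_comm]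
      gcongr
      exact hC a ha τ hτ'.le
    refine ⟨hbi.mono' (hmeas 0) (hb 0 le_rfl), ?_⟩
    -- The value at `a = 0` is the limit of the values at `a n > 0`, with the decay in `τ` coming
    -- from `σ ≠ 0` instead of `a`.
    set a : ℕ → ℝ := fun n => 1 / ((n : ℝ) + 1) with ha_def
    have ha0 : ∀ n, 0 < a n := fun n => by positivity
    have hlim : Tendsto a atTop (𝓝 0) := tendsto_one_div_add_atTop_nhds_zero_nat
    have h1 : Tendsto (fun n => ∫ τ in Ioi (0 : ℝ), ((τ ^ (α + dim - 1 - 1) : ℝ) : ℂ) *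
        mehlerFourier α (a n) σ τ) atTop (𝓝 (∫ τ in Ioi (0 : ℝ),
          ((τ ^ (α + dim - 1 - 1) : ℝ) : ℂ) * mehlerFourier α 0 σ τ)) := by
      refine tendsto_integral_of_dominated_convergence _ (fun n => hmeas (a n)) hbi
        (fun n => hb _ (ha0 n).le) ?_
      filter_upwards [ae_restrict_mem measurableSet_Ioi] with τ hτ
      refine Tendsto.const_mul _ (tendsto_integral_of_dominated_convergence _
        (fun n => (integrable_mehlerFourier_integrand hα (ha0 n).le
          (le_of_lt hτ) σ).aestronglyMeasurable) hF
        (fun n => ae_norm_mehlerFourier_integrand_le α (ha0 n).le (le_of_lt hτ) σ)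
        (Eventually.of_forall fun l => ?_))
      refine Tendsto.const_mul _ (Tendsto.ofReal ?_)
      have hcont : Continuous fun b : ℝ => mehlerProfile α (τ * b) ‖l‖ := by
        unfold mehlerProfile
        fun_prop
      exact (hcont.tendsto 0).comp hlim
    have h2 : Tendsto (fun n => ((hyperboloidConst α dim (a n ^ 2 + ‖σ‖ ^ 2) * Real.Gamma (α / 2) /
        √Real.pi : ℝ) : ℂ)) atTop (𝓝 ((hyperboloidConst α dim (0 ^ 2 + ‖σ‖ ^ 2) *
          Real.Gamma (α / 2) / √Real.pi : ℝ) : ℂ)) := by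
      refine Tendsto.ofReal (Tendsto.div_const (Tendsto.mul_const _ ?_) _)
      unfold hyperboloidConst
      refine Tendsto.mul_const _ (Tendsto.const_mul _ (Tendsto.rpow_const
        ((hlim.pow 2).add_const _) (Or.inl (by positivity))))
    refine tendsto_nhds_unique h1 (h2.congr fun n => ?_)
    exact (integral_rpow_mul_integral_mehlerProfile hα (ha0 n) hF σ).symm
  · refine ⟨?_, integral_rpow_mul_integral_mehlerProfile hα ha hF σ⟩
    have := (integrable_prod_mehlerProfile (V := V) ha hp hF σ).integral_prod_right
    simp only [integral_const_mul] at this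
    exact this

end Potential

/-! ### Inversion of time and the constants -/

section Mehler

variable {m k : ℕ}

lemma mehlerIntegrand_eq (α : ℝ) (z : EuclideanSpace ℝ (Fin m)) (σ : EuclideanSpace ℝ (Fin k))
    (t : ℝ) (l : EuclideanSpace ℝ (Fin k)) :
    mehlerIntegrand α z σ t l = Complex.exp (-Complex.I * ((t⁻¹ * inner ℝ σ l : ℝ) : ℂ)) *
      (mehlerProfile α (t⁻¹ * (‖z‖ ^ 2 / 4)) ‖l‖ : ℝ) := by
  unfold mehlerIntegrand mehlerProfile
  rw [show t⁻¹ * (‖z‖ ^ 2 / 4) = ‖z‖ ^ 2 / (4 * t) by rw [inv_mul_eq_div, div_div]]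
  congr 2
  push_cast
  ring

/-- The factor `|-1| t^(-1-1)` is the Jacobian of `τ = t^(-1)`, in the shape that the change of
variables for powers expects. -/
lemma mehlerKernel_eq {α β t : ℝ} (ht : 0 < t) (z : EuclideanSpace ℝ (Fin m))
    (σ : EuclideanSpace ℝ (Fin k)) :
    mehlerKernel α β z σ t = (|(-1 : ℝ)| * t ^ ((-1 : ℝ) - 1)) •
      (((2 ^ k / (4 * Real.pi) ^ β : ℝ) : ℂ) * ((((t ^ (-1 : ℝ)) ^ (β - 1 - 1) : ℝ) : ℂ) *
        mehlerFourier α (‖z‖ ^ 2 / 4) σ (t ^ (-1 : ℝ)))) := by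
  have hpow : 2 ^ k / (4 * Real.pi * t) ^ β = |(-1 : ℝ)| * t ^ ((-1 : ℝ) - 1) *
      (2 ^ k / (4 * Real.pi) ^ β * (t ^ (-1 : ℝ)) ^ (β - 1 - 1)) := by
    have h1 : (t ^ β)⁻¹ = t ^ ((-1 : ℝ) - 1) * (t ^ (-1 : ℝ)) ^ (β - 1 - 1) := by
      rw [← Real.rpow_mul ht.le, ← Real.rpow_add ht, ← Real.rpow_neg ht.le]
      ring_nf
    rw [Real.mul_rpow (by positivity) ht.le, abs_neg, abs_one, one_mul, ← div_div,
      div_eq_mul_inv _ (t ^ β), h1]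
    ring
  have hF : ∫ l, mehlerIntegrand α z σ t l = mehlerFourier α (‖z‖ ^ 2 / 4) σ (t ^ (-1 : ℝ)) := by
    simp_rw [mehlerIntegrand_eq, mehlerFourier, Real.rpow_neg_one]
  unfold mehlerKernel
  rw [hF, hpow, Complex.real_smul]
  push_cast
  ring

/-- Since `(‖z‖²/4)² + ‖σ‖²` is the fourth power of the gauge divided by `16`, only powers of `2`
and `π` need to be collected. -/
lemma hyperboloidConst_eq_koranyiGauge {α : ℝ} (z : EuclideanSpace ℝ (Fin m))
    (σ : EuclideanSpace ℝ (Fin k)) :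
    2 ^ k / (4 * Real.pi) ^ (α + k) *
      (hyperboloidConst α k ((‖z‖ ^ 2 / 4) ^ 2 + ‖σ‖ ^ 2) * Real.Gamma (α / 2) / √Real.pi) =
    (2 : ℝ) ^ (α + 2 * k - 4) * Real.Gamma (α / 2) * Real.Gamma ((α + k - 1) / 2) /
      Real.pi ^ ((2 * α + k + 1) / 2) * koranyiGauge z σ ^ (-(2 * α + 2 * k - 2)) := by
  have hπ := Real.pi_pos
  unfold hyperboloidConst koranyiGauge
  set Q := ‖z‖ ^ 4 + 16 * ‖σ‖ ^ 2 with hQ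
  have hQ0 : 0 ≤ Q := by positivity
  have h4 : ∀ x : ℝ, (4 : ℝ) ^ x = 2 ^ (2 * x) := fun x => by
    rw [Real.rpow_mul two_pos.le]
    norm_num
  have h16 : ∀ x : ℝ, (16 : ℝ) ^ x = 2 ^ (4 * x) := fun x => by
    rw [Real.rpow_mul two_pos.le]
    norm_num
  have hQe : ((‖z‖ ^ 2 / 4) ^ 2 + ‖σ‖ ^ 2) ^ (-((α + k - 1) / 2)) =
      (Q ^ (1 / 4 : ℝ)) ^ (-(2 * α + 2 * k - 2)) * 2 ^ (2 * (α + k - 1)) := by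
    rw [show (‖z‖ ^ 2 / 4) ^ 2 + ‖σ‖ ^ 2 = Q / 16 by rw [hQ]; ring,
      Real.div_rpow hQ0 (by norm_num), ← Real.rpow_mul hQ0, h16, div_eq_mul_inv,
      ← Real.rpow_neg two_pos.le]
    ring_nf
  have h2e : (2 : ℝ) ^ (α + 2 * k - 4) = 2 ^ k * 2 ^ (-(2 * (α + k))) * (1 / 2) *
      2 ^ (2 * ((α + k - 1) / 2)) * 2 ^ (2 * (α + k - 1)) := by
    rw [show (1 / 2 : ℝ) = 2 ^ (-1 : ℝ) by rw [Real.rpow_neg_one]; norm_num, ← Real.rpow_natCast 2 k,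
      ← Real.rpow_add two_pos, ← Real.rpow_add two_pos, ← Real.rpow_add two_pos,
      ← Real.rpow_add two_pos]
    ring_nf
  have hπe : (Real.pi ^ ((2 * α + k + 1) / 2))⁻¹ = (Real.pi ^ (α + k))⁻¹ * Real.pi ^ ((k : ℝ) / 2) *
      (√Real.pi)⁻¹ := by
    rw [Real.sqrt_eq_rpow, ← Real.rpow_neg hπ.le, ← Real.rpow_neg hπ.le, ← Real.rpow_neg hπ.le,
      ← Real.rpow_add hπ, ← Real.rpow_add hπ]
    ring_nf
  rw [hQe, h2e, div_eq_mul_inv _ (Real.pi ^ _), hπe, Real.mul_rpow (by norm_num) hπ.le, h4, h4,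
    Real.rpow_neg two_pos.le]
  ring

end Mehler

theorem theorem1p3 (m k : ℕ) (hk : 1 ≤ k) (α : ℝ) (hα : 0 < α)
    (z : EuclideanSpace ℝ (Fin m)) (σ : EuclideanSpace ℝ (Fin k)) (hzσ : (z, σ) ≠ (0, 0)) :
    (∀ t : ℝ, 0 < t → Integrable (mehlerIntegrand α z σ t)) ∧
    IntegrableOn (mehlerKernel α (α + k) z σ) (Set.Ioi 0) ∧
    mehlerPotential α (α + k) z σ =
      (((2 : ℝ) ^ (α + 2 * k - 4) * Real.Gamma (α / 2) * Real.Gamma ((α + k - 1) / 2) /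
          Real.pi ^ ((2 * α + k + 1) / 2) *
        koranyiGauge z σ ^ (-(2 * α + 2 * k - 2)) : ℝ) : ℂ) := by
  have hfin : Module.finrank ℝ (EuclideanSpace ℝ (Fin k)) = k := finrank_euclideanSpace_fin
  have : Nontrivial (EuclideanSpace ℝ (Fin k)) :=
    Module.nontrivial_of_finrank_pos (R := ℝ) (by rw [hfin]; omega)
  have ha : 0 ≤ ‖z‖ ^ 2 / 4 := by positivity
  have hne : ‖z‖ ^ 2 / 4 ≠ 0 ∨ σ ≠ 0 := by
    by_contra! hcon
    refine hzσ (Prod.ext ?_ hcon.2)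
    simpa using hcon.1
  obtain ⟨hint, hval⟩ := integral_rpow_mul_mehlerFourier hα ha hne
  rw [hfin] at hint hval
  have hint' := Integrable.const_mul hint ((2 ^ k / (4 * Real.pi) ^ (α + k) : ℝ) : ℂ)
  have hcongr : EqOn (mehlerKernel α (α + k) z σ) _ (Ioi 0) := fun t ht => mehlerKernel_eq ht z σ
  refine ⟨fun t ht => ?_, ?_, ?_⟩
  · rw [funext (mehlerIntegrand_eq α z σ t)]
    exact integrable_mehlerFourier_integrand hα ha (inv_nonneg.2 ht.le) σ
  · refine IntegrableOn.congr_fun ?_ hcongr.symm measurableSet_Ioi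
    exact (integrableOn_Ioi_comp_rpow_iff _ (by norm_num : (-1 : ℝ) ≠ 0)).2 hint'
  · rw [mehlerPotential, setIntegral_congr_fun measurableSet_Ioi hcongr,
      integral_comp_rpow_Ioi (fun τ : ℝ => ((2 ^ k / (4 * Real.pi) ^ (α + k) : ℝ) : ℂ) *
        (((τ ^ (α + k - 1 - 1) : ℝ) : ℂ) * mehlerFourier α (‖z‖ ^ 2 / 4) σ τ))
        (by norm_num : (-1 : ℝ) ≠ 0), integral_const_mul, hval, ← Complex.ofReal_mul,
      hyperboloidConst_eq_koranyiGauge]
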